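/- **Setting.** Let $\mathcal X$ be a finite set (for instance $\mathcal X=[N]^D$). A *transition rate* is a family $u=(u_t(y,x))_{t\in[0,1],\,x,y\in\mathcal X}$, measurable in $t$, with $u_t(y,x)\ge 0$ for $y\ne x$ and $\sum_y u_t(y,x)=0$; here $u_t(y,x)$ is the rate of jumping from $x$ to $y$. Path measures are probability measures on the space of càdlàg paths $[0,1]\to\mathcal X$ with coordinate process $(X_t)$. The path measure $P$ of the continuous-time Markov chain (CTMC) with rate $u$ and initial law $\mu$ is understood through the martingale problem: $P(X_0=\cdot)=\mu$, $\int_0^1 |u_t(y,x)|\,P(X_t=x)\,dt<\infty$ for all $x,y$, and for every $y$ the process $1_{\{X_t=y\}}-\int_0^t u_w(y,X_w)\,dw$ is a $P$-martingale. We write $P_t(x)=P(X_t=x)$ and $P_{t|s}(x|y)=P(X_t=x\mid X_s=y)$. Let $\mu,\nu$ be probability distributions on $\mathcal X$, and let $r$ be a reference rate with $\int_0^1|r_t(y,x)|\,dt<\infty$ for all $x,y$. Let $p^r$ be the path measure of the CTMC with rate $r$ and initial law $\mu$, and let $p^r_{t|s}(y|x)$, $0\le s\le t\le 1$, be the transition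 kernel of that chain, i.e. the family of stochastic matrices, continuous in $t$, satisfying the Chapman–Kolmogorov equations and $p^r_{t|s}(y|x)=1_{y=x}+\int_s^t\sum_z r_w(y,z)\,p^r_{w|s}(z|x)\,dw$. Consider the Schrödinger bridge problem $$\min_{u}\ \mathrm{KL}(p^u\,\|\,p^r)\quad\text{subject to } p^u_0=\mu,\ p^u_1=\nu, \tag{SB}$$ where the minimum runs over all transition rates $u$ and path measures $p^u$ of CTMCs with rate $u$ and initial law $\mu$. Assume that there is a coupling $\pi$ of $\mu$ and $\nu$ such that $\pi(x,y)>0$ if and only if $\mu(x)>0$, $p^r_{1|0}(y|x)>0$ and $\nu(y)>0$. (This holds, with $\pi=\mu\otimes\nu$, whenever $p^r_{1|0}(y|x)>0$ for all $x,y$.) **Theorem.** There are nonnegative functions $\varphi_t,\widehat\varphi_t$ on $\mathcal X$, $t\in[0,1]$ (the SB potentials), such that for all $0\le s<t\le 1$ and $x\in\mathcal X$ $$\varphi_s(x)=\sum_y p^r_{t|s}(y|x)\,\varphi_t(y),\qquad \widehat\varphi_t(x)=\sum_y p^r_{t|s}(x|y)\,\widehat\varphi_s(y),$$ and a path measure $p^\star$,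 such that the following hold. 1. The rate $$u^\star_t(y,x)=\frac{\varphi_t(y)}{\varphi_t(x)}\,r_t(y,x)\quad(y\ne x),\qquad u^\star_t(x,x)=-\sum_{z\ne x}u^\star_t(z,x)$$ (with $u^\star_t(\cdot,x)=0$ if $\varphi_t(x)=0$) is optimal for (SB), with path measure $p^\star$. Conversely, every optimal pair $(u,p^u)$ satisfies $p^u=p^\star$ and, for almost every $t\in[0,1]$, $u_t(y,x)=\frac{\varphi_t(y)}{\varphi_t(x)}r_t(y,x)$ for all $y\ne x$ with $p^\star_t(x)>0$. Moreover, at every $t\in[0,1)$ at which $r$ is right-continuous, $$\lim_{h\downarrow0}\frac{p^\star_{t+h|t}(y|x)}{h}=\frac{\varphi_t(y)}{\varphi_t(x)}\,r_t(y,x)\qquad\text{for all } y\ne x\text{ with }p^\star_t(x)>0.$$ 2. $p^\star_t(x)=\varphi_t(x)\,\widehat\varphi_t(x)$ for all $t\in[0,1]$ and $x\in\mathcal X$; in particular $\varphi_0\widehat\varphi_0=\mu$ and $\varphi_1\widehat\varphi_1=\nu$. 3. For all $0\le s<t\le1$ and $x,y\in\mathcal X$, $$p^\star_{t|s}(x|y)=p^r_{t|s}(x|y)\,\frac{\varphi_t(x)}{\varphi_s(y)}\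 \text{ if } p^\star_s(y)>0,\qquad p^\star_{s|t}(y|x)=p^r_{t|s}(x|y)\,\frac{\widehat\varphi_s(y)}{\widehat\varphi_t(x)}\ \text{ if } p^\star_t(x)>0.$$ -/

import Mathlib

open MeasureTheory Set Filter Topology

namespace SchrodingerBridge

/-- Càdlàg functions from `[0,1]` to the discrete space `X`: at every time the function is
eventually constant from the right, with value the current one, and eventually constant from
the left. -/
def PathSpace (X : Type*) : Type _ :=
  {ω : Icc (0 : ℝ) 1 → X //
    ∀ t, (∀ᶠ s in 𝓝[>] t, ω s = ω t) ∧ ∃ x, ∀ᶠ s in 𝓝[<] t, ω s = x}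

/-- The coordinate process `X_t`. Only times `t ∈ [0,1]` matter (other times are clamped). -/
noncomputable def PathSpace.at {X : Type*} (ω : PathSpace X) (t : ℝ) : X :=
  ω.1 (Set.projIcc 0 1 zero_le_one t)

/-- The σ-algebra on path space generated by all coordinates. -/
noncomputable instance PathSpace.instMeasurableSpace (X : Type*) : MeasurableSpace (PathSpace X) :=
  ⨆ t : ℝ, MeasurableSpace.comap (fun ω : PathSpace X => ω.at t) ⊤

/-- The σ-algebra of the past up to time `s`, generated by the coordinates at times `≤ s`. -/
@[reducible] noncomputable def past (X : Type*) (s : ℝ) : MeasurableSpace (PathSpace X) :=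
  ⨆ t : {t : ℝ // t ≤ s}, MeasurableSpace.comap (fun ω : PathSpace X => ω.at t.1) ⊤

/-- The event `X_t = x`. -/
noncomputable def event {X : Type*} (t : ℝ) (x : X) : Set (PathSpace X) := {ω | ω.at t = x}

/-- The marginal `P_t(x) = P(X_t = x)`. -/
noncomputable def marginal {X : Type*} (P : Measure (PathSpace X)) (t : ℝ) (x : X) : ℝ :=
  P.real (event t x)

/-- The conditional probability `P(X_t = x | X_s = y)`, for arbitrary times `s`, `t`. -/
noncomputable def condProb {X : Type*} (P : Measure (PathSpace X)) (t s : ℝ) (x y : X) : ℝ :=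
  (ProbabilityTheory.cond P (event s y)).real (event t x)

/-- A (time-dependent) transition rate on `[0,1]`; `u t y x` is the rate of jumping from `x` to
`y` at time `t`. -/
structure IsRate {X : Type*} [Fintype X] (u : ℝ → X → X → ℝ) : Prop where
  aemeasurable : ∀ y x, AEMeasurable (fun t => u t y x) (volume.restrict (Icc 0 1))
  nonneg : ∀ t ∈ Icc (0 : ℝ) 1, ∀ y x, y ≠ x → 0 ≤ u t y x
  sum_eq_zero : ∀ t ∈ Icc (0 : ℝ) 1, ∀ x, ∑ y, u t y x = 0

/-- `P` is the path measure of the continuous-time Markov chain on `[0,1]` with transition rate `u`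
and initial distribution `μ`. It is stated as the martingale problem: for every `y`,
`1_{X_t = y} - ∫₀ᵗ u_w(y, X_w) dw` is a martingale for the filtration of the process, tested here
on the events `A` of the past of `s`, with the expectation taken inside the time integral.
(In particular `P` is Markov, and its marginals satisfy the Kolmogorov forward equation.) -/
structure IsPathMeasure {X : Type*} [Fintype X] (u : ℝ → X → X → ℝ) (μ : X → ℝ)
    (P : Measure (PathSpace X)) : Prop where
  isProbabilityMeasure : IsProbabilityMeasure P
  initial : ∀ x, marginal P 0 x = μ x
  integrable : ∀ y x, IntegrableOn (fun t => u t y x * marginal P t x) (Icc 0 1)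
  evolution : ∀ s t : ℝ, 0 ≤ s → s ≤ t → t ≤ 1 →
    ∀ A : Set (PathSpace X), MeasurableSet[past X s] A → ∀ y,
      P.real (A ∩ event t y) =
        P.real (A ∩ event s y) + ∫ w in s..t, ∑ z, u w y z * P.real (A ∩ event w z)

/-- `p s t y x = p_{t|s}(y|x)`, `0 ≤ s ≤ t ≤ 1`, is the transition kernel of the continuous-time
Markov chain with rate `r`. -/
structure IsTransitionKernel {X : Type*} [Fintype X] [DecidableEq X] (r : ℝ → X → X → ℝ)
    (p : ℝ → ℝ → X → X → ℝ) : Prop where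
  nonneg : ∀ s t, 0 ≤ s → s ≤ t → t ≤ 1 → ∀ y x, 0 ≤ p s t y x
  sum_eq_one : ∀ s t, 0 ≤ s → s ≤ t → t ≤ 1 → ∀ x, ∑ y, p s t y x = 1
  chapman_kolmogorov : ∀ s w t, 0 ≤ s → s ≤ w → w ≤ t → t ≤ 1 → ∀ y x,
    p s t y x = ∑ z, p w t y z * p s w z x
  continuousOn : ∀ s, 0 ≤ s → s ≤ 1 → ∀ y x, ContinuousOn (fun t => p s t y x) (Icc s 1)
  forward : ∀ s t, 0 ≤ s → s ≤ t → t ≤ 1 → ∀ y x,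
    p s t y x = (if y = x then 1 else 0) + ∫ w in s..t, ∑ z, r w y z * p s w z x

/-- `(u, P)` is admissible: `P` is the path measure `p^u` of a chain with rate `u` and initial
distribution `μ`, and its terminal distribution is `ν`. -/
structure IsAdmissible {X : Type*} [Fintype X] (μ ν : X → ℝ)
    (u : ℝ → X → X → ℝ) (P : Measure (PathSpace X)) : Prop where
  isRate : IsRate u
  isPathMeasure : IsPathMeasure u μ P
  terminal : ∀ x, marginal P 1 x = ν x

/-- `(u, P)` solves the Schrödinger bridge problem: minimise `KL(p^u ‖ p^r)` over the rates `u`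
with `p^u_0 = μ` and `p^u_1 = ν`. -/
structure IsOptimal {X : Type*} [Fintype X] (μ ν : X → ℝ) (Pr : Measure (PathSpace X))
    (u : ℝ → X → X → ℝ) (P : Measure (PathSpace X)) : Prop where
  admissible : IsAdmissible μ ν u P
  le : ∀ u' P', IsAdmissible μ ν u' P' →
    InformationTheory.klDiv P Pr ≤ InformationTheory.klDiv P' Pr

/-- The rate with off-diagonal entries `φ_t(y) / φ_t(x) * r_t(y,x)` and columns summing to zero. -/
noncomputable def tiltedRate {X : Type*} [Fintype X] [DecidableEq X] (r : ℝ → X → X → ℝ)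
    (φ : ℝ → X → ℝ) (t : ℝ) (y x : X) : ℝ :=
  if y = x then - ∑ z ∈ Finset.univ.erase x, φ t z / φ t x * r t z x
  else φ t y / φ t x * r t y x

end SchrodingerBridge

namespace SchrodingerBridge

/-! The optimal path measure is an endpoint reweighting of the reference chain, `P* = α(X_0) b(X_1)
Pr`, where the pair `(α, b)` is chosen so that the endpoint marginals are `μ` and `ν`. Such a pair
comes from minimising relative entropy over couplings of `μ` and `ν`: the support hypothesis on the
given coupling makes the minimiser strictly positive on the admissible pairs, and Lagrange
multipliers then force the product form (`exists_schrodinger_system`).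

Put `φ_t = E[b(X_1) | X_t = ·]` and let `φ̂` be the propagation of `μ α` from time 0. By the Markov
property of `Pr`, the law of `(X_s, X_t)` under `P*` is `φ̂_s p_{t|s} φ_t`
(`tiltedMeasure_real_event_inter_event`), which yields marginals and conditionals. That `P*` is a
chain with the tilted rate is Doob's h-transform: `P*(A, X_t = y)` is the product of a solution of
the forward equation and of `φ`, a solution of the backward equation, and the product rule gives the
forward equation of the tilted rate (`evolution_tiltedMeasure`).

The logarithm of the density of `P*` depends only on the endpoints, so it has the same mean under
every admissible `P`. Hence `KL(P‖Pr) = KL(P‖P*) + KL(P*‖Pr)` whenever the left side is finite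
(`toReal_klDiv_eq_add_klDiv_tiltedMeasure`), which gives optimality and uniqueness of `P*`. The rate
of a path measure is recovered by testing the martingale problem on `{X_s = x}` and letting `s`
increase to `t` (`ae_rate_eq_of_isPathMeasure`).

Since `r` is only integrable in time, equations are used in integrated form and uniqueness rests on
a sewing argument (`eq_of_abs_sub_le_mul_sq`). -/

/-! ### Real analysis: quadratically small increments and the product rule. -/

lemma abs_sub_le_mul_sq_div_two_pow {E M : ℝ → ℝ} {s t C : ℝ}
    (hM : ContinuousOn M (Icc s t))
    (h : ∀ u v, s ≤ u → u ≤ v → v ≤ t → |E v - E u| ≤ C * (M v - M u) ^ 2)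
    (hmono : MonotoneOn M (Icc s t)) (n : ℕ) :
    ∀ u v, s ≤ u → u ≤ v → v ≤ t → |E v - E u| ≤ C * (M v - M u) ^ 2 / 2 ^ n := by
  induction n with
  | zero => simpa using h
  | succ n ih =>
    intro u v hu huv hv
    have hle : M u ≤ M v := hmono ⟨hu, huv.trans hv⟩ ⟨hu.trans huv, hv⟩ huv
    -- Bisect where `M` takes the mean of its end values. Each half carries half of the
    -- `M`-increment, so the sum of the two quadratic bounds is half the original one.
    obtain ⟨m, hm, hmeq⟩ : (M u + M v) / 2 ∈ M '' Icc u v :=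
      intermediate_value_Icc huv (hM.mono (Icc_subset_Icc hu hv))
        ⟨by linarith, by linarith⟩
    have h1 := ih u m hu hm.1 (hm.2.trans hv)
    have h2 := ih m v (hu.trans hm.1) hm.2 hv
    have h3 : |E v - E u| ≤ |E v - E m| + |E m - E u| := abs_sub_le _ _ _
    rw [hmeq] at h1 h2
    refine h3.trans ((add_le_add h2 h1).trans (le_of_eq ?_))
    rw [pow_succ]
    field_simp
    ring

/-- A function whose increments are quadratically small with respect to a continuous monotone
function is constant. -/
lemma eq_of_abs_sub_le_mul_sq {E M : ℝ → ℝ} {s t C : ℝ} (hst : s ≤ t)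
    (hM : ContinuousOn M (Icc s t)) (hmono : MonotoneOn M (Icc s t))
    (h : ∀ u v, s ≤ u → u ≤ v → v ≤ t → |E v - E u| ≤ C * (M v - M u) ^ 2) : E t = E s := by
  have hlim : Tendsto (fun n : ℕ => C * (M t - M s) ^ 2 / 2 ^ n) atTop (𝓝 0) :=
    tendsto_const_nhds.div_atTop (tendsto_pow_atTop_atTop_of_one_lt (by norm_num))
  have := ge_of_tendsto' hlim
    (fun n => abs_sub_le_mul_sq_div_two_pow hM h hmono n s t le_rfl hst le_rfl)
  exact sub_eq_zero.1 (abs_nonpos_iff.1 this)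

/-- Product rule for primitives of integrable functions. -/
lemma mul_sub_mul_eq_integral {F G f g : ℝ → ℝ} {s t : ℝ} (hst : s ≤ t)
    (hf : IntervalIntegrable f volume s t) (hg : IntervalIntegrable g volume s t)
    (hF : ∀ w ∈ Icc s t, F w = F s + ∫ v in s..w, f v)
    (hG : ∀ w ∈ Icc s t, G w = G s + ∫ v in s..w, g v) :
    F t * G t - F s * G s = ∫ w in s..t, (f w * G w + F w * g w) := by
  -- The primitives are absolutely continuous and agree with `F`, `G` on `[s,t]`, so integration by
  -- parts applies to them.
  set F' : ℝ → ℝ := fun w => F s + ∫ v in s..w, f v with hF'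
  set G' : ℝ → ℝ := fun w => G s + ∫ v in s..w, g v with hG'
  have acP : ∀ {f : ℝ → ℝ} (c : ℝ), IntervalIntegrable f volume s t →
      AbsolutelyContinuousOnInterval (fun w => c + ∫ v in s..w, f v) s t := by
    intro f c hf
    have := hf.absolutelyContinuousOnInterval_intervalIntegral (c := s) (by simp)
    rw [absolutelyContinuousOnInterval_iff] at this ⊢
    simpa using this
  have h1 := (acP (F s) hf).integral_deriv_mul_eq_sub (acP (G s) hg)
  have e : ∀ w ∈ Icc s t, F w = F' w ∧ G w = G' w := fun w hw => ⟨hF w hw, hG w hw⟩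
  rw [(e t ⟨hst, le_rfl⟩).1, (e t ⟨hst, le_rfl⟩).2, (e s ⟨le_rfl, hst⟩).1,
    (e s ⟨le_rfl, hst⟩).2, ← h1]
  apply intervalIntegral.integral_congr_ae
  filter_upwards [hf.ae_hasDerivAt_integral, hg.ae_hasDerivAt_integral] with w h1 h2 hw
  have hw' : w ∈ uIcc s t := uIoc_subset_uIcc hw
  have hw'' : w ∈ Icc s t := by rwa [uIcc_of_le hst] at hw'
  rw [(e w hw'').1, (e w hw'').2, ((h1 hw' s (by simp)).const_add _).deriv,
    ((h2 hw' s (by simp)).const_add _).deriv]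

/-! ### The cumulative rate as a continuous monotone clock controlling all increments. -/

variable {X : Type*}

lemma intervalIntegrable_rate {r : ℝ → X → X → ℝ}
    (hr : ∀ y x, IntegrableOn (fun t => r t y x) (Icc 0 1)) {s t : ℝ} (hs : 0 ≤ s) (hst : s ≤ t) (ht : t ≤ 1) (y x : X) :
    IntervalIntegrable (fun w => r w y x) volume s t := by
  rw [intervalIntegrable_iff_integrableOn_Ioc_of_le hst]
  exact (hr y x).mono_set (Ioc_subset_Icc_self.trans (Icc_subset_Icc hs ht))

lemma intervalIntegrable_rate_mul {r : ℝ → X → X → ℝ}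
    (hr : ∀ y x, IntegrableOn (fun t => r t y x) (Icc 0 1)) {s t : ℝ} {a : ℝ → X → ℝ} (hs : 0 ≤ s) (hst : s ≤ t)
    (ht : t ≤ 1) (ha : ∀ z, ContinuousOn (fun w => a w z) (Icc s t)) (y z : X) :
    IntervalIntegrable (fun w => r w y z * a w z) volume s t :=
  (intervalIntegrable_rate hr hs hst ht y z).mul_continuousOn (by rw [uIcc_of_le hst]; exact ha z)

variable [Fintype X]

lemma intervalIntegrable_sum {f : X → ℝ → ℝ} {s t : ℝ}
    (h : ∀ x, IntervalIntegrable (f x) volume s t) :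
    IntervalIntegrable (fun w => ∑ x, f x w) volume s t := by
  simpa only [Finset.sum_fn] using IntervalIntegrable.sum Finset.univ fun x _ => h x

/-- The sum of the absolute values of all the rates at time `w`. -/
noncomputable def totalRate (r : ℝ → X → X → ℝ) (w : ℝ) : ℝ := ∑ y, ∑ x, |r w y x|

/-- The integral of the total rate up to time `t`. -/
noncomputable def cumRate (r : ℝ → X → X → ℝ) (t : ℝ) : ℝ := ∫ w in (0 : ℝ)..t, totalRate r w

lemma totalRate_nonneg (r : ℝ → X → X → ℝ) (w : ℝ) : 0 ≤ totalRate r w :=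
  Finset.sum_nonneg fun _ _ => Finset.sum_nonneg fun _ _ => abs_nonneg _

lemma abs_sum_rate_mul_le {r : ℝ → X → X → ℝ} {w D : ℝ} {d : X → ℝ} (y : X)
    (hd : ∀ z, |d z| ≤ D) : |∑ z, r w y z * d z| ≤ D * totalRate r w := by
  have hD : ∀ z : X, 0 ≤ D := fun z => (abs_nonneg _).trans (hd z)
  calc |∑ z, r w y z * d z| ≤ ∑ z, |r w y z| * D := by
        refine (Finset.abs_sum_le_sum_abs _ _).trans (Finset.sum_le_sum fun z _ => ?_)
        rw [abs_mul]
        exact mul_le_mul_of_nonneg_left (hd z) (abs_nonneg _)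
    _ = D * ∑ z, |r w y z| := by rw [← Finset.sum_mul, mul_comm]
    _ ≤ D * totalRate r w := by
        refine mul_le_mul_of_nonneg_left ?_ (hD y)
        exact Finset.single_le_sum (f := fun y => ∑ x, |r w y x|)
          (fun _ _ => Finset.sum_nonneg fun _ _ => abs_nonneg _) (Finset.mem_univ y)

lemma abs_sum_sum_rate_mul_le {r : ℝ → X → X → ℝ} {w D : ℝ} {d : X → X → ℝ}
    (hd : ∀ y z, |d y z| ≤ D) : |∑ y, ∑ z, r w y z * d y z| ≤ D * totalRate r w := by
  rw [totalRate, Finset.mul_sum]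
  refine (Finset.abs_sum_le_sum_abs _ _).trans (Finset.sum_le_sum fun y _ => ?_)
  rw [Finset.mul_sum]
  refine (Finset.abs_sum_le_sum_abs _ _).trans (Finset.sum_le_sum fun z _ => ?_)
  rw [abs_mul, mul_comm]
  exact mul_le_mul_of_nonneg_right (hd y z) (abs_nonneg _)

section Integrable

variable {r : ℝ → X → X → ℝ} (hr : ∀ y x, IntegrableOn (fun t => r t y x) (Icc 0 1))
include hr

lemma intervalIntegrable_totalRate {s t : ℝ} (hs : 0 ≤ s) (hst : s ≤ t) (ht : t ≤ 1) :
    IntervalIntegrable (totalRate r) volume s t := by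
  rw [intervalIntegrable_iff_integrableOn_Ioc_of_le hst]
  refine integrable_finsetSum _ fun y _ => integrable_finsetSum _ fun x _ => Integrable.abs ?_
  exact (hr y x).mono_set (Ioc_subset_Icc_self.trans (Icc_subset_Icc hs ht))

lemma cumRate_sub {s t : ℝ} (hs : 0 ≤ s) (hst : s ≤ t) (ht : t ≤ 1) :
    cumRate r t - cumRate r s = ∫ w in s..t, totalRate r w := by
  rw [cumRate, cumRate, intervalIntegral.integral_interval_sub_left]
  · exact intervalIntegrable_totalRate hr le_rfl (hs.trans hst) ht
  · exact intervalIntegrable_totalRate hr le_rfl hs (hst.trans ht)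

lemma monotoneOn_cumRate : MonotoneOn (cumRate r) (Icc 0 1) := by
  intro s hs t ht hst
  rw [← sub_nonneg, cumRate_sub hr hs.1 hst ht.2]
  exact intervalIntegral.integral_nonneg hst fun w _ => totalRate_nonneg r w

lemma continuousOn_cumRate : ContinuousOn (cumRate r) (Icc 0 1) := by
  have := intervalIntegral.continuousOn_primitive_interval' (a := (0 : ℝ))
    (intervalIntegrable_totalRate hr le_rfl zero_le_one le_rfl) (by simp)
  rwa [uIcc_of_le zero_le_one] at this

lemma abs_integral_le_cumRate {f : ℝ → ℝ} {s t D : ℝ} (hs : 0 ≤ s) (hst : s ≤ t) (ht : t ≤ 1)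
    (hf : ∀ w ∈ Icc s t, |f w| ≤ D * totalRate r w) :
    |∫ w in s..t, f w| ≤ D * (cumRate r t - cumRate r s) := by
  rw [cumRate_sub hr hs hst ht, ← intervalIntegral.integral_const_mul]
  exact intervalIntegral.norm_integral_le_of_norm_le (f := f) hst
    (ae_of_all _ fun w hw => hf w (Ioc_subset_Icc_self hw))
    ((intervalIntegrable_totalRate hr hs hst ht).const_mul D)

lemma continuousOn_of_abs_sub_le_cumRate {a : ℝ → ℝ} {s t D : ℝ} (hs : 0 ≤ s) (ht : t ≤ 1)
    (h : ∀ u v, s ≤ u → u ≤ v → v ≤ t → |a v - a u| ≤ D * (cumRate r v - cumRate r u)) :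
    ContinuousOn a (Icc s t) := by
  have hM : ContinuousOn (cumRate r) (Icc s t) :=
    (continuousOn_cumRate hr).mono (Icc_subset_Icc hs ht)
  intro u hu
  have h1 : Tendsto (fun v => D * |cumRate r v - cumRate r u|) (𝓝[Icc s t] u) (𝓝 0) := by
    have : Tendsto (fun v => D * |cumRate r v - cumRate r u|) (𝓝[Icc s t] u)
        (𝓝 (D * |cumRate r u - cumRate r u|)) :=
      (((hM u hu).sub tendsto_const_nhds).abs).const_mul D
    simpa using this
  rw [ContinuousWithinAt, tendsto_iff_norm_sub_tendsto_zero]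
  refine squeeze_zero' (Eventually.of_forall fun _ => norm_nonneg _) ?_ h1
  filter_upwards [self_mem_nhdsWithin] with v hv
  rcases le_total u v with huv | huv
  · have hm := monotoneOn_cumRate hr ⟨hs.trans hu.1, hu.2.trans ht⟩
      ⟨hs.trans hv.1, hv.2.trans ht⟩ huv
    rw [abs_of_nonneg (sub_nonneg.2 hm)]
    exact h u v hu.1 huv hv.2
  · have hm := monotoneOn_cumRate hr ⟨hs.trans hv.1, hv.2.trans ht⟩
      ⟨hs.trans hu.1, hu.2.trans ht⟩ huv
    rw [abs_sub_comm (cumRate r v), abs_of_nonneg (sub_nonneg.2 hm), norm_sub_rev]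
    exact h v u hv.1 huv hu.2

end Integrable

/-! ### Uniqueness for the Kolmogorov forward equation. -/

section Kernel

variable [DecidableEq X] {r : ℝ → X → X → ℝ} {p : ℝ → ℝ → X → X → ℝ}
  (hr : ∀ y x, IntegrableOn (fun t => r t y x) (Icc 0 1)) (hp : IsTransitionKernel r p)

include hp in
lemma kernel_le_one {s t : ℝ} (hs : 0 ≤ s) (hst : s ≤ t) (ht : t ≤ 1) (y x : X) :
    p s t y x ≤ 1 := by
  rw [← hp.sum_eq_one s t hs hst ht x]
  exact Finset.single_le_sum (f := fun y => p s t y x)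
    (fun y _ => hp.nonneg s t hs hst ht y x) (Finset.mem_univ y)

include hp in
lemma abs_kernel_le_one {s t : ℝ} (hs : 0 ≤ s) (hst : s ≤ t) (ht : t ≤ 1) (y x : X) :
    |p s t y x| ≤ 1 := by
  rw [abs_of_nonneg (hp.nonneg s t hs hst ht y x)]
  exact kernel_le_one hp hs hst ht y x

include hp in
lemma kernel_self {s : ℝ} (hs : 0 ≤ s) (hs' : s ≤ 1) (y x : X) :
    p s s y x = if y = x then 1 else 0 := by
  rw [hp.forward s s hs le_rfl hs' y x]
  simp

include hr hp in
lemma abs_kernel_sub_le {s t : ℝ} (hs : 0 ≤ s) (hst : s ≤ t) (ht : t ≤ 1) (y x : X) :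
    |p s t y x - if y = x then 1 else 0| ≤ cumRate r t - cumRate r s := by
  rw [hp.forward s t hs hst ht y x, add_sub_cancel_left, ← one_mul (cumRate r t - _)]
  exact abs_integral_le_cumRate hr hs hst ht fun w hw =>
    abs_sum_rate_mul_le y fun z => abs_kernel_le_one hp hs hw.1 (hw.2.trans ht) z x

include hr hp in
/-- Uniqueness for the forward equation: its bounded solutions are propagated by the kernel. -/
lemma forward_solution_eq {a : ℝ → X → ℝ} {s t D : ℝ} (hs : 0 ≤ s) (hst : s ≤ t) (ht : t ≤ 1)
    (haD : ∀ w ∈ Icc s t, ∀ z, |a w z| ≤ D)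
    (ha : ∀ u v, s ≤ u → u ≤ v → v ≤ t → ∀ y, a v y = a u y + ∫ w in u..v, ∑ z, r w y z * a w z)
    (y : X) : a t y = ∑ z, p s t y z * a s z := by
  have hac : ∀ z, ContinuousOn (fun w => a w z) (Icc s t) := fun z =>
    continuousOn_of_abs_sub_le_cumRate (D := D) hr hs ht fun u v hu huv hv => by
      rw [ha u v hu huv hv, add_sub_cancel_left]
      exact abs_integral_le_cumRate hr (hs.trans hu) huv (hv.trans ht) fun w hw =>
        abs_sum_rate_mul_le z fun x => haD w ⟨hu.trans hw.1, hw.2.trans hv⟩ x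
  set D' : ℝ := D + ∑ _z : X, D with hD'
  -- On `[u,v]`, `a` and its propagation from time `u` solve the same linear equation with the same
  -- initial value, so their difference satisfies the homogeneous integral equation `hdint`.
  have key : ∀ u v, s ≤ u → u ≤ v → v ≤ t → ∀ z,
      |a v z - ∑ x, p u v z x * a u x| ≤ D' * (cumRate r v - cumRate r u) ^ 2 := by
    intro u v hu huv hv
    have h0u : 0 ≤ u := hs.trans hu
    have hv1 : v ≤ 1 := hv.trans ht
    set d : ℝ → X → ℝ := fun w z => a w z - ∑ x, p u w z x * a u x with hd
    have hdint : ∀ w ∈ Icc u v, ∀ z, d w z = ∫ q in u..w, ∑ x, r q z x * d q x := by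
      intro w hw z
      have i1 : ∀ x, IntervalIntegrable (fun q => r q z x * a q x) volume u w :=
        intervalIntegrable_rate_mul hr h0u hw.1 (hw.2.trans hv1)
          (fun z => (hac z).mono (Icc_subset_Icc hu (hw.2.trans hv))) z
      have i2 : ∀ x x', IntervalIntegrable (fun q => r q z x' * p u q x' x) volume u w :=
        fun x x' => intervalIntegrable_rate_mul (a := fun q x' => p u q x' x) hr h0u hw.1
          (hw.2.trans hv1) (fun x' => (hp.continuousOn u h0u (huv.trans hv1) x' x).mono
            (Icc_subset_Icc le_rfl (hw.2.trans hv1))) z x'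
      have e1 : ∀ x, p u w z x * a u x = (if z = x then a u x else 0) +
          ∫ q in u..w, a u x * ∑ x', r q z x' * p u q x' x := by
        intro x
        rw [hp.forward u w h0u hw.1 (hw.2.trans hv1) z x, add_mul,
          intervalIntegral.integral_const_mul]
        split_ifs <;> ring
      simp only [hd]
      rw [Finset.sum_congr rfl fun x _ => e1 x, Finset.sum_add_distrib,
        Finset.sum_ite_eq, if_pos (Finset.mem_univ z), ha u w hu hw.1 (hw.2.trans hv) z,
        ← intervalIntegral.integral_finsetSum, add_sub_add_left_eq_sub,
        ← intervalIntegral.integral_sub]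
      · refine intervalIntegral.integral_congr fun q _ => ?_
        simp only [mul_sub, Finset.sum_sub_distrib, Finset.mul_sum]
        congr 1
        rw [Finset.sum_comm]
        exact Finset.sum_congr rfl fun _ _ => Finset.sum_congr rfl fun _ _ => by ring
      · exact intervalIntegrable_sum fun x => i1 x
      · exact intervalIntegrable_sum fun x =>
          (intervalIntegrable_sum fun x' => i2 x x').const_mul _
      · exact fun x _ => (intervalIntegrable_sum fun x' => i2 x x').const_mul _
    have hdb : ∀ w ∈ Icc u v, ∀ z, |d w z| ≤ D' := by
      intro w hw z
      refine (abs_sub _ _).trans (add_le_add (haD w ⟨hu.trans hw.1, hw.2.trans hv⟩ z) ?_)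
      refine (Finset.abs_sum_le_sum_abs _ _).trans (Finset.sum_le_sum fun x _ => ?_)
      rw [abs_mul]
      have h1 := abs_kernel_le_one hp h0u hw.1 (hw.2.trans hv1) z x
      have h2 := haD u ⟨hu, huv.trans hv⟩ x
      calc _ ≤ 1 * D := mul_le_mul h1 h2 (abs_nonneg _) zero_le_one
        _ = D := one_mul D
    intro z
    have hD0 : 0 ≤ D' := (abs_nonneg _).trans (hdb u ⟨le_rfl, huv⟩ z)
    have hmono : ∀ w ∈ Icc u v, cumRate r w ≤ cumRate r v := fun w hw =>
      monotoneOn_cumRate hr ⟨h0u.trans hw.1, hw.2.trans hv1⟩ ⟨h0u.trans huv, hv1⟩ hw.2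
    -- Feeding the constant bound `hdb` into `hdint` gives a linear bound; feeding that in again
    -- gives the quadratic one.
    have step1 : ∀ w ∈ Icc u v, ∀ z, |d w z| ≤ D' * (cumRate r v - cumRate r u) := by
      intro w hw z
      rw [hdint w hw z]
      refine (abs_integral_le_cumRate hr h0u hw.1 (hw.2.trans hv1) fun q hq =>
        abs_sum_rate_mul_le z fun x => hdb q ⟨hq.1, hq.2.trans hw.2⟩ x).trans ?_
      exact mul_le_mul_of_nonneg_left (by linarith [hmono w hw]) hD0
    change |d v z| ≤ _
    rw [hdint v ⟨huv, le_rfl⟩ z, pow_two, ← mul_assoc]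
    exact abs_integral_le_cumRate hr h0u huv hv1 fun q hq =>
        abs_sum_rate_mul_le z fun x => step1 q hq x
  -- Propagating `a w` to the final time `t` gives a function of `w` that is constant: by
  -- Chapman–Kolmogorov its increments are the local errors of `key` multiplied by a kernel bounded
  -- by 1.
  have hE : (fun w => ∑ z, p w t y z * a w z) t = (fun w => ∑ z, p w t y z * a w z) s := by
    refine eq_of_abs_sub_le_mul_sq (E := fun w => ∑ z, p w t y z * a w z) (M := cumRate r) (C := ∑ _z : X, D') hst
      ((continuousOn_cumRate hr).mono (Icc_subset_Icc hs ht))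
      ((monotoneOn_cumRate hr).mono (Icc_subset_Icc hs ht)) fun u v hu huv hv => ?_
    have e : (∑ z, p v t y z * a v z) - ∑ z, p u t y z * a u z =
        ∑ z, p v t y z * (a v z - ∑ x, p u v z x * a u x) := by
      simp only [mul_sub, Finset.sum_sub_distrib]
      congr 1
      simp_rw [hp.chapman_kolmogorov u v t (hs.trans hu) huv hv ht y, Finset.sum_mul,
        Finset.mul_sum]
      rw [Finset.sum_comm]
      exact Finset.sum_congr rfl fun _ _ => Finset.sum_congr rfl fun _ _ => by ring
    rw [e, Finset.sum_mul]
    refine (Finset.abs_sum_le_sum_abs _ _).trans (Finset.sum_le_sum fun z _ => ?_)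
    rw [abs_mul]
    have h1 := abs_kernel_le_one hp (hs.trans (hu.trans huv)) hv ht y z
    calc _ ≤ 1 * (D' * (cumRate r v - cumRate r u) ^ 2) :=
          mul_le_mul h1 (key u v hu huv hv z) (abs_nonneg _) zero_le_one
      _ = _ := one_mul _
  simp only at hE
  rw [← hE]
  simp [kernel_self hp (hs.trans hst) ht]

end Kernel

/-! ### Backward equation for space-time harmonic functions. -/

section Potential

variable {X : Type*} [Fintype X] [DecidableEq X] {r : ℝ → X → X → ℝ} {p : ℝ → ℝ → X → X → ℝ}
  {φ : ℝ → X → ℝ} {C : ℝ}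
  (hr : ∀ y x, IntegrableOn (fun t => r t y x) (Icc 0 1)) (hp : IsTransitionKernel r p)
  (hφ : ∀ s t, 0 ≤ s → s ≤ t → t ≤ 1 → ∀ x, φ s x = ∑ y, p s t y x * φ t y)
  (hC : ∀ t ∈ Icc (0 : ℝ) 1, ∀ x, |φ t x| ≤ C)

include hr hp hφ hC

lemma abs_potential_sub_le {s t : ℝ} (hs : 0 ≤ s) (hst : s ≤ t) (ht : t ≤ 1) (x : X) :
    |φ t x - φ s x| ≤ (∑ _y : X, C) * (cumRate r t - cumRate r s) := by
  have e : φ s x - φ t x = ∑ y, (p s t y x - if y = x then 1 else 0) * φ t y := by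
    rw [hφ s t hs hst ht x]
    simp [sub_mul]
  rw [abs_sub_comm, e, Finset.sum_mul]
  refine (Finset.abs_sum_le_sum_abs _ _).trans (Finset.sum_le_sum fun y _ => ?_)
  rw [abs_mul, mul_comm]
  exact mul_le_mul (hC t ⟨hs.trans hst, ht⟩ y) (abs_kernel_sub_le hr hp hs hst ht y x)
    (abs_nonneg _) ((abs_nonneg _).trans (hC t ⟨hs.trans hst, ht⟩ y))

lemma continuousOn_potential (x : X) : ContinuousOn (fun t => φ t x) (Icc 0 1) :=
  continuousOn_of_abs_sub_le_cumRate hr le_rfl le_rfl fun _ _ hu huv hv =>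
    abs_potential_sub_le hr hp hφ hC hu huv hv x

lemma intervalIntegrable_sum_rate_mul_potential {s t : ℝ} (hs : 0 ≤ s) (hst : s ≤ t)
    (ht : t ≤ 1) (x : X) :
    IntervalIntegrable (fun w => ∑ y, r w y x * φ w y) volume s t :=
  intervalIntegrable_sum fun y => (intervalIntegrable_rate hr hs hst ht y x).mul_continuousOn
    (by
      rw [uIcc_of_le hst]
      exact (continuousOn_potential hr hp hφ hC y).mono (Icc_subset_Icc hs ht))

/-- The Kolmogorov backward equation. -/
lemma potential_backward {s t : ℝ} (hs : 0 ≤ s) (hst : s ≤ t) (ht : t ≤ 1) (x : X) :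
    φ t x = φ s x + ∫ w in s..t, -∑ y, r w y x * φ w y := by
  -- Only the forward equation of `p` is available. It gives the increments of `φ` with `φ` frozen
  -- at the right end point; the error in replacing it by the backward integrand is of second order.
  have hE : (fun t => φ t x + ∫ w in (0 : ℝ)..t, ∑ y, r w y x * φ w y) t =
      (fun t => φ t x + ∫ w in (0 : ℝ)..t, ∑ y, r w y x * φ w y) s := by
    refine eq_of_abs_sub_le_mul_sq (E := fun t => φ t x + ∫ w in (0 : ℝ)..t, ∑ y, r w y x * φ w y)
      (M := cumRate r) (C := C + ∑ _y : X, C) hst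
      ((continuousOn_cumRate hr).mono (Icc_subset_Icc hs ht))
      ((monotoneOn_cumRate hr).mono (Icc_subset_Icc hs ht)) fun u v hu huv hv => ?_
    have h0u : 0 ≤ u := hs.trans hu
    have hv1 : v ≤ 1 := hv.trans ht
    have hC0 : 0 ≤ C := (abs_nonneg _).trans (hC u ⟨h0u, huv.trans hv1⟩ x)
    have i1 : ∀ y z, IntervalIntegrable (fun w => r w y z * p u w z x) volume u v :=
      fun y z => intervalIntegrable_rate_mul (a := fun w z => p u w z x) hr h0u huv hv1
        (fun z => (hp.continuousOn u h0u (huv.trans hv1) z x).mono (Icc_subset_Icc le_rfl hv1)) y z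
    have e1 : φ v x - φ u x =
        - ∫ w in u..v, ∑ y, φ v y * ∑ z, r w y z * p u w z x := by
      rw [hφ u v h0u huv hv1 x, intervalIntegral.integral_finsetSum
        (fun y _ => (intervalIntegrable_sum fun z => i1 y z).const_mul _)]
      simp_rw [intervalIntegral.integral_const_mul, hp.forward u v h0u huv hv1, add_mul]
      simp [Finset.sum_add_distrib, mul_comm]
    have e2 : (∫ w in (0 : ℝ)..v, ∑ y, r w y x * φ w y) - ∫ w in (0 : ℝ)..u, ∑ y, r w y x * φ w y
        = ∫ w in u..v, ∑ y, r w y x * φ w y :=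
      intervalIntegral.integral_interval_sub_left
        (intervalIntegrable_sum_rate_mul_potential hr hp hφ hC le_rfl (h0u.trans huv) hv1 x)
        (intervalIntegrable_sum_rate_mul_potential hr hp hφ hC le_rfl h0u (huv.trans hv1) x)
    have e3 : (φ v x + ∫ w in (0 : ℝ)..v, ∑ y, r w y x * φ w y) -
        (φ u x + ∫ w in (0 : ℝ)..u, ∑ y, r w y x * φ w y) =
        -- The bracket is first order in the clock, since the kernel is close to the identity and
        -- `φ` varies slowly; integrating it against the rate gives the second factor.
        ∫ w in u..v, ∑ y, ∑ z, r w y z * ((if z = x then φ w y else 0) - φ v y * p u w z x) := by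
      rw [add_sub_add_comm, e1, e2, neg_add_eq_sub, ← intervalIntegral.integral_sub
        (intervalIntegrable_sum_rate_mul_potential hr hp hφ hC h0u huv hv1 x)
        (intervalIntegrable_sum fun y => (intervalIntegrable_sum fun z => i1 y z).const_mul _)]
      refine intervalIntegral.integral_congr fun w _ => ?_
      simp only [mul_sub, Finset.sum_sub_distrib, Finset.mul_sum, mul_ite, mul_zero,
        Finset.sum_ite_eq', Finset.mem_univ, if_true]
      congr 1
      exact Finset.sum_congr rfl fun _ _ => Finset.sum_congr rfl fun _ _ => by ring
    rw [e3, pow_two, ← mul_assoc]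
    refine abs_integral_le_cumRate hr h0u huv hv1 fun w hw => abs_sum_sum_rate_mul_le fun y z => ?_
    have hw0 : 0 ≤ w := h0u.trans hw.1
    have hw1 : w ≤ 1 := hw.2.trans hv1
    have m1 := monotoneOn_cumRate hr ⟨h0u, huv.trans hv1⟩ ⟨hw0, hw1⟩ hw.1
    have m2 := monotoneOn_cumRate hr ⟨hw0, hw1⟩ ⟨h0u.trans huv, hv1⟩ hw.2
    have b1 : |φ v y * ((if z = x then 1 else 0) - p u w z x)| ≤
        C * (cumRate r v - cumRate r u) := by
      rw [abs_mul, abs_sub_comm]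
      exact mul_le_mul (hC v ⟨h0u.trans huv, hv1⟩ y)
        ((abs_kernel_sub_le hr hp h0u hw.1 hw1 z x).trans (by linarith)) (abs_nonneg _) hC0
    have hK0 : 0 ≤ ∑ _y : X, C := Finset.sum_nonneg fun _ _ => hC0
    have b2 : |if z = x then φ w y - φ v y else 0| ≤
        (∑ _y : X, C) * (cumRate r v - cumRate r u) := by
      split_ifs
      · rw [abs_sub_comm]
        refine (abs_potential_sub_le hr hp hφ hC hw0 hw.2 hv1 y).trans ?_
        exact mul_le_mul_of_nonneg_left (by linarith) hK0
      · rw [abs_zero]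
        exact mul_nonneg hK0 (by linarith)
    have e4 : (if z = x then φ w y else 0) - φ v y * p u w z x =
        φ v y * ((if z = x then 1 else 0) - p u w z x) + if z = x then φ w y - φ v y else 0 := by
      split_ifs <;> ring
    rw [e4, add_mul]
    exact (abs_add_le _ _).trans (add_le_add b1 b2)
  have hsplit := intervalIntegral.integral_interval_sub_left
    (intervalIntegrable_sum_rate_mul_potential hr hp hφ hC le_rfl (hs.trans hst) ht x)
    (intervalIntegrable_sum_rate_mul_potential hr hp hφ hC le_rfl hs (hst.trans ht) x)
  simp only at hE
  rw [intervalIntegral.integral_neg, ← hsplit]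
  linarith

/-- For almost every time, the chain cannot jump from a zero of the potential to a state where
the potential is positive. -/
lemma ae_rate_mul_potential_eq_zero (hrate : IsRate r)
    (hφ0 : ∀ t ∈ Icc (0 : ℝ) 1, ∀ x, 0 ≤ φ t x) :
    ∀ᵐ w ∂(volume.restrict (Icc (0 : ℝ) 1)), ∀ x, φ w x = 0 → ∀ y, r w y x * φ w y = 0 := by
  rw [ae_restrict_iff' measurableSet_Icc]
  have hae : ∀ᵐ w : ℝ, w ≠ 0 ∧ w ≠ 1 := by
    have h0 : ∀ᵐ w : ℝ, w ≠ 0 := by simp [ae_iff, measure_singleton]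
    have h1 : ∀ᵐ w : ℝ, w ≠ 1 := by simp [ae_iff, measure_singleton]
    exact h0.and h1
  have hd : ∀ᵐ w : ℝ, ∀ x, w ∈ uIcc (0 : ℝ) 1 → ∀ c ∈ uIcc (0 : ℝ) 1,
      HasDerivAt (fun v => ∫ q in c..v, -∑ y, r q y x * φ q y) (-∑ y, r w y x * φ w y) w :=
    ae_all_iff.2 fun x => (intervalIntegrable_sum_rate_mul_potential hr hp hφ hC le_rfl
      zero_le_one le_rfl x).neg.ae_hasDerivAt_integral
  filter_upwards [hae, hd] with w hw01 hdw hw x hx y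
  have hd' := (hdw x (by rwa [uIcc_of_le zero_le_one]) 0 (by simp)).const_add (φ 0 x)
  have hnhds : Icc (0 : ℝ) 1 ∈ 𝓝 w :=
    Icc_mem_nhds (lt_of_le_of_ne hw.1 (Ne.symm hw01.1)) (lt_of_le_of_ne hw.2 hw01.2)
  -- A zero of the nonnegative function `φ · x` is a minimum, so its derivative `-∑ r φ` vanishes
  -- there. The off-diagonal terms of that sum are nonnegative and the diagonal one is zero, hence
  -- each term vanishes.
  have hmin : IsLocalMin (fun v => φ 0 x + ∫ q in (0 : ℝ)..v, -∑ y, r q y x * φ q y) w := by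
    filter_upwards [hnhds] with v hv
    rw [← potential_backward hr hp hφ hC le_rfl hv.1 hv.2 x,
      ← potential_backward hr hp hφ hC le_rfl hw.1 hw.2 x, hx]
    exact hφ0 v hv x
  have hsum : ∑ y, r w y x * φ w y = 0 := neg_eq_zero.1 (hmin.hasDerivAt_eq_zero hd')
  refine (Finset.sum_eq_zero_iff_of_nonneg fun y _ => ?_).1 hsum y (Finset.mem_univ y)
  by_cases hyx : y = x
  · rw [hyx, hx, mul_zero]
  · exact mul_nonneg (hrate.nonneg w hw y x hyx) (hφ0 w hw y)

end Potential

/-! ### Static problem: entropy minimisation and the Schrödinger system. -/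

/-- The relative entropy, up to a linear term, of a nonnegative vector. -/
noncomputable def discreteEntropy {Q : Type*} [Fintype Q] (c π : Q → ℝ) : ℝ :=
  ∑ q, (π q * Real.log (π q) - π q * c q)

/-- Relative entropy under linear constraints, some strictly positive vector being feasible: there
is a strictly positive minimiser, and its logarithm is a combination of the constraints. -/
lemma exists_log_eq_add_sum_mul {Q ι : Type*} [Fintype Q] [DecidableEq Q] [Fintype ι]
    (L : ι → (Q → ℝ) →ₗ[ℝ] ℝ) (c π₀ : Q → ℝ) (B : ℝ) (hpos : ∀ q, 0 < π₀ q)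
    (hB : ∀ π : Q → ℝ, (∀ q, 0 ≤ π q) → (∀ i, L i π = L i π₀) → ∀ q, π q ≤ B) :
    ∃ π : Q → ℝ, (∀ q, 0 < π q) ∧ (∀ i, L i π = L i π₀) ∧
      ∃ l : ι → ℝ, ∀ q, Real.log (π q) = c q + ∑ i, l i * L i (Pi.single q 1) := by
  set K : Set (Q → ℝ) := {π | (∀ q, 0 ≤ π q) ∧ ∀ i, L i π = L i π₀} with hK
  have hKclosed : IsClosed K := by
    rw [hK, ofPred_and]
    refine IsClosed.inter ?_ ?_
    · rw [ofPred_forall]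
      exact isClosed_iInter fun q => isClosed_le continuous_const (continuous_apply q)
    · rw [ofPred_forall]
      exact isClosed_iInter fun i =>
        isClosed_eq (L i).continuous_of_finiteDimensional continuous_const
  have hKcompact : IsCompact K :=
    (isCompact_Icc (a := (0 : Q → ℝ)) (b := fun _ => B)).of_isClosed_subset hKclosed
      fun π hπ => ⟨fun q => hπ.1 q, fun q => hB π hπ.1 hπ.2 q⟩
  -- The shift by 1 cancels the 1 in the derivative of `x log x`, so the gradient of the functional
  -- is exactly `log π - c`.
  have hcont : Continuous (discreteEntropy fun q => c q + 1) := by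
    unfold discreteEntropy
    refine continuous_finsetSum _ fun q _ => Continuous.sub ?_ ?_
    · exact Real.continuous_mul_log.comp (continuous_apply q)
    · exact (continuous_apply q).mul continuous_const
  obtain ⟨π, hπK, hπmin⟩ := hKcompact.exists_isMinOn
    ⟨π₀, fun q => (hpos q).le, fun _ => rfl⟩ hcont.continuousOn
  set J : (Q → ℝ) → ℝ := discreteEntropy fun q => c q + 1 with hJ
  have hπpos : ∀ q, 0 < π q := by
    intro q₀
    by_contra hq₀
    have hq₀' : π q₀ = 0 := le_antisymm (not_lt.1 hq₀) (hπK.1 q₀)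
    -- If a coordinate of the minimiser vanished, moving a fraction `ε` towards `π₀` would change
    -- `J` by at most `O(ε)` plus the term `ε log ε * π₀ q₀`. Minimality bounds this below by zero,
    -- which fails for small `ε`.
    have key : ∀ ε : ℝ, 0 < ε → ε < 1 → 0 ≤ J π₀ - J π + Real.log ε * π₀ q₀ := by
      intro ε h0 h1
      set σ : Q → ℝ := (1 - ε) • π + ε • π₀ with hσ
      have hσK : σ ∈ K := by
        refine ⟨fun q => ?_, fun i => ?_⟩
        · have h2 := mul_nonneg (sub_nonneg.2 h1.le) (hπK.1 q)
          have h3 := mul_nonneg h0.le (hpos q).le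
          simpa [hσ] using add_nonneg h2 h3
        · rw [hσ, map_add, map_smul, map_smul, hπK.2 i, smul_eq_mul, smul_eq_mul]
          ring
      have hle : J π ≤ J σ := hπmin hσK
      have hub : J σ ≤ (1 - ε) * J π + ε * J π₀ + ε * Real.log ε * π₀ q₀ := by
        have hq : ∀ q, σ q * Real.log (σ q) - σ q * (c q + 1) ≤
            (1 - ε) * (π q * Real.log (π q) - π q * (c q + 1)) +
              ε * (π₀ q * Real.log (π₀ q) - π₀ q * (c q + 1)) +
              if q = q₀ then ε * Real.log ε * π₀ q₀ else 0 := by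
          intro q
          have hσq : σ q = (1 - ε) * π q + ε * π₀ q := by simp [hσ]
          split_ifs with hqq
          · subst hqq
            rw [hσq, hq₀', mul_zero, zero_add, Real.log_mul h0.ne' (hpos q).ne']
            apply le_of_eq
            ring
          · have := Real.convexOn_mul_log.2 (hπK.1 q) (hpos q).le (sub_nonneg.2 h1.le) h0.le
              (sub_add_cancel 1 ε)
            simp only [smul_eq_mul] at this
            rw [hσq]
            linarith
        calc J σ ≤ ∑ q, ((1 - ε) * (π q * Real.log (π q) - π q * (c q + 1)) +
              ε * (π₀ q * Real.log (π₀ q) - π₀ q * (c q + 1)) +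
              if q = q₀ then ε * Real.log ε * π₀ q₀ else 0) := Finset.sum_le_sum fun q _ => hq q
          _ = _ := by
            rw [Finset.sum_add_distrib, Finset.sum_add_distrib, ← Finset.mul_sum,
              ← Finset.mul_sum, Finset.sum_ite_eq', if_pos (Finset.mem_univ q₀)]
            rfl
      have h4 : 0 ≤ ε * (J π₀ - J π + Real.log ε * π₀ q₀) := by nlinarith
      exact nonneg_of_mul_nonneg_right h4 h0
    have hb := hpos q₀
    -- This `ε` makes `log ε * π₀ q₀` equal to `-(|J π₀ - J π| + 1)`.
    have h5 := key (Real.exp (-((|J π₀ - J π| + 1) / π₀ q₀))) (Real.exp_pos _)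
      (Real.exp_lt_one_iff.2 (neg_neg_of_pos (by positivity)))
    rw [Real.log_exp, neg_mul, div_mul_cancel₀ _ hb.ne'] at h5
    linarith [le_abs_self (J π₀ - J π)]
  set T : (Q → ℝ) →ₗ[ℝ] ℝ :=
    ∑ q, (Real.log (π q) - c q) • (LinearMap.proj q : (Q → ℝ) →ₗ[ℝ] ℝ) with hT
  have hTapp : ∀ h : Q → ℝ, T h = ∑ q, (Real.log (π q) - c q) * h q := by
    intro h
    simp [hT]
  -- Positivity of `π` makes every direction killed by the constraints feasible both ways, so the
  -- differential `T` of `J` vanishes on it and therefore lies in the span of the constraints: these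
  -- are the Lagrange multipliers.
  have hker : (⨅ i, LinearMap.ker (L i)) ≤ LinearMap.ker T := by
    intro h hh
    have hh' : ∀ i, L i h = 0 := by simpa [Submodule.mem_iInf] using hh
    have hderiv : HasDerivAt (fun ε : ℝ => J (π + ε • h)) (T h) 0 := by
      rw [hTapp]
      have : ∀ q ∈ Finset.univ, HasDerivAt (fun ε : ℝ => (π q + ε * h q) * Real.log (π q + ε * h q)
          - (π q + ε * h q) * (c q + 1)) ((Real.log (π q) - c q) * h q) 0 := by
        intro q _
        have h1 : HasDerivAt (fun ε : ℝ => π q + ε * h q) (h q) 0 := by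
          simpa using ((hasDerivAt_id (0 : ℝ)).mul_const (h q)).const_add (π q)
        have h2 : HasDerivAt (fun x : ℝ => x * Real.log x) (Real.log (π q) + 1)
            (π q + 0 * h q) := by
          simpa using Real.hasDerivAt_mul_log (hπpos q).ne'
        have h3 := (h2.comp 0 h1).sub (h1.mul_const (c q + 1))
        convert! h3 using 1
        ring
      simpa [hJ, discreteEntropy] using HasDerivAt.fun_sum this
    have hmin : IsLocalMin (fun ε : ℝ => J (π + ε • h)) 0 := by
      have hev : ∀ᶠ ε : ℝ in 𝓝 0, ∀ q, 0 < (π + ε • h) q := by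
        rw [eventually_all]
        intro q
        have : Continuous fun ε : ℝ => (π + ε • h) q := by
          simp only [Pi.add_apply, Pi.smul_apply, smul_eq_mul]
          fun_prop
        exact this.continuousAt.eventually (lt_mem_nhds (by simpa using hπpos q))
      filter_upwards [hev] with ε hε
      simp only [zero_smul, add_zero]
      refine hπmin ⟨fun q => (hε q).le, fun i => ?_⟩
      rw [map_add, map_smul, hh' i, smul_zero, add_zero, hπK.2 i]
    exact hmin.hasDerivAt_eq_zero hderiv
  obtain ⟨l, hl⟩ := (Submodule.mem_span_range_iff_exists_fun ℝ).1 (mem_span_of_iInf_ker_le_ker hker)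
  refine ⟨π, hπpos, hπK.2, l, fun q => ?_⟩
  have h1 := hTapp (Pi.single q 1)
  rw [← hl] at h1
  simp only [LinearMap.coe_sum, LinearMap.smul_apply, Finset.sum_apply, smul_eq_mul,
    Pi.single_apply, mul_ite, mul_one, mul_zero, Finset.sum_ite_eq', Finset.mem_univ,
    if_true] at h1
  linarith

/-- Solvability of the (static) Schrödinger system. -/
lemma exists_schrodinger_system {X : Type*} [Fintype X] [DecidableEq X] (k : X → X → ℝ)
    (hk : ∀ y x, 0 ≤ k y x) (μ ν : X → ℝ) (hμ : ∀ x, 0 ≤ μ x) 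
    (hfeas : ∃ π : X → X → ℝ, (∀ x y, 0 ≤ π x y) ∧ (∀ x, ∑ y, π x y = μ x) ∧
      (∀ y, ∑ x, π x y = ν y) ∧ ∀ x y, 0 < π x y ↔ 0 < μ x ∧ 0 < k y x ∧ 0 < ν y) :
    ∃ α b : X → ℝ, (∀ x, 0 < α x) ∧ (∀ y, 0 ≤ b y) ∧
      (∀ x, μ x * α x * ∑ y, k y x * b y = μ x) ∧
      ∀ y, (∑ x, k y x * (μ x * α x)) * b y = ν y := by
  classical
  obtain ⟨π, hπ0, hπμ, hπν, hπS⟩ := hfeas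
  set S : X × X → Prop := fun q => 0 < μ q.1 ∧ 0 < k q.2 q.1 ∧ 0 < ν q.2 with hS
  -- The constraints are the row and column sums of a matrix supported on `S`, where the given
  -- coupling is strictly positive.
  let L : X ⊕ X → (Subtype S → ℝ) →ₗ[ℝ] ℝ := Sum.elim
    (fun x => ∑ q : Subtype S, (if q.1.1 = x then (1 : ℝ) else 0) • LinearMap.proj q)
    (fun y => ∑ q : Subtype S, (if q.1.2 = y then (1 : ℝ) else 0) • LinearMap.proj q)
  have hLl : ∀ x f, L (Sum.inl x) f = ∑ q : Subtype S, if q.1.1 = x then f q else 0 := by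
    intro x f
    simp only [L, Sum.elim_inl, LinearMap.coe_sum, Finset.sum_apply,
      LinearMap.smul_apply, LinearMap.proj_apply, smul_eq_mul, ite_mul, one_mul, zero_mul]
  have hLr : ∀ y f, L (Sum.inr y) f = ∑ q : Subtype S, if q.1.2 = y then f q else 0 := by
    intro y f
    simp only [L, Sum.elim_inr, LinearMap.coe_sum, Finset.sum_apply,
      LinearMap.smul_apply, LinearMap.proj_apply, smul_eq_mul, ite_mul, one_mul, zero_mul]
  have hsub : ∀ G : X × X → ℝ, (∀ q, ¬ S q → G q = 0) → ∑ q : Subtype S, G q.1 = ∑ q, G q := by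
    intro G hG
    rw [← Finset.sum_filter_add_sum_filter_not Finset.univ S G,
      Finset.sum_eq_zero (s := Finset.univ.filter fun q => ¬ S q)
        (fun q hq => hG q (Finset.mem_filter.1 hq).2), add_zero]
    exact (Finset.sum_subtype (Finset.univ.filter S)
      (fun q => by rw [Finset.mem_filter]; exact and_iff_right (Finset.mem_univ q)) G).symm
  have hLl' : ∀ (x : X) (G : X × X → ℝ), (∀ q, ¬ S q → G q = 0) →
      L (Sum.inl x) (fun q => G q.1) = ∑ y, G (x, y) := by
    intro x G hG
    rw [hLl, hsub (fun q => if q.1 = x then G q else 0) (fun q hq => by simp [hG q hq]),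
      Fintype.sum_prod_type_right]
    simp
  have hLr' : ∀ (y : X) (G : X × X → ℝ), (∀ q, ¬ S q → G q = 0) →
      L (Sum.inr y) (fun q => G q.1) = ∑ x, G (x, y) := by
    intro y G hG
    rw [hLr, hsub (fun q => if q.2 = y then G q else 0) (fun q hq => by simp [hG q hq]),
      Fintype.sum_prod_type]
    simp
  have hπz : ∀ q : X × X, ¬ S q → π q.1 q.2 = 0 := fun q hq =>
    le_antisymm (not_lt.1 fun h => hq ((hπS q.1 q.2).1 h)) (hπ0 _ _)
  -- The reference weight is `μ x * k y x`, the endpoint law of the chain; each entry is bounded by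
  -- its row sum, hence by the total mass of `μ`.
  obtain ⟨σ, hσ0, hσL, l, hl⟩ := exists_log_eq_add_sum_mul L
    (fun q => Real.log (μ q.1.1 * k q.1.2 q.1.1)) (fun q => π q.1.1 q.1.2) (∑ x, μ x)
    (fun q => (hπS _ _).2 q.2) (by
      intro f hf hL q
      have h1 : f q ≤ L (Sum.inl q.1.1) f := by
        rw [hLl]
        have := Finset.single_le_sum (f := fun q' : Subtype S => if q'.1.1 = q.1.1 then f q' else 0)
          (fun q' _ => by split_ifs <;> simp [hf]) (Finset.mem_univ q)
        simpa using this
      rw [hL, hLl' q.1.1 (fun q => π q.1 q.2) hπz, hπμ] at h1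
      exact h1.trans (Finset.single_le_sum (f := μ) (fun x _ => hμ x) (Finset.mem_univ _)))
  set α : X → ℝ := fun x => Real.exp (l (Sum.inl x)) with hα
  -- Zero off the support of `ν`, so that the product form `G` vanishes outside `S`; `α` can stay
  -- positive because `μ` already appears in `G`.
  set b : X → ℝ := fun y => if 0 < ν y then Real.exp (l (Sum.inr y)) else 0 with hb
  set G : X × X → ℝ := fun q => μ q.1 * k q.2 q.1 * (α q.1 * b q.2) with hG
  have hGz : ∀ q, ¬ S q → G q = 0 := by
    intro q hq
    by_contra hne
    simp only [hG, mul_ne_zero_iff] at hne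
    refine hq ⟨lt_of_le_of_ne (hμ _) (Ne.symm hne.1.1), lt_of_le_of_ne (hk _ _) (Ne.symm hne.1.2),
      ?_⟩
    by_contra h
    exact hne.2.2 (by simp [hb, h])
  have hGσ : (fun q : Subtype S => G q.1) = σ := by
    funext q
    have h1 := hl q
    rw [Fintype.sum_sum_type] at h1
    simp only [hLl, hLr] at h1
    simp only [Pi.single_apply] at h1
    have e1 : ∀ x : X, (∑ q' : Subtype S, if q'.1.1 = x then (if q' = q then (1 : ℝ) else 0) else 0)
        = if q.1.1 = x then 1 else 0 := by
      intro x
      rw [Finset.sum_eq_single q (fun q' _ hq' => by simp [hq']) (by simp)]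
      simp
    have e2 : ∀ y : X, (∑ q' : Subtype S, if q'.1.2 = y then (if q' = q then (1 : ℝ) else 0) else 0)
        = if q.1.2 = y then 1 else 0 := by
      intro x
      rw [Finset.sum_eq_single q (fun q' _ hq' => by simp [hq']) (by simp)]
      simp
    simp only [e1, e2, mul_ite, mul_one, mul_zero, Finset.sum_ite_eq, Finset.mem_univ,
      if_true] at h1
    rw [← Real.exp_log (hσ0 q), h1, Real.exp_add, Real.exp_add,
      Real.exp_log (mul_pos q.2.1 q.2.2.1)]
    simp [hG, hα, hb, q.2.2.2]
  refine ⟨α, b, fun x => Real.exp_pos _, fun y => ?_, fun x => ?_, fun y => ?_⟩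
  · simp only [hb]
    split_ifs
    · exact (Real.exp_pos _).le
    · exact le_rfl
  · have h1 := hσL (Sum.inl x)
    rw [← hGσ, hLl' x G hGz, hLl' x (fun q => π q.1 q.2) hπz, hπμ] at h1
    rw [Finset.mul_sum]
    refine Eq.trans ?_ h1
    exact Finset.sum_congr rfl fun y _ => by simp only [hG]; ring
  · have h1 := hσL (Sum.inr y)
    rw [← hGσ, hLr' y G hGz, hLr' y (fun q => π q.1 q.2) hπz, hπν] at h1
    rw [Finset.sum_mul]
    refine Eq.trans ?_ h1
    exact Finset.sum_congr rfl fun x _ => by simp only [hG]; ring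

/-! ### Events and one-time functionals on path space. -/

section Events

variable {X : Type*}

lemma past_le (s : ℝ) : past X s ≤ PathSpace.instMeasurableSpace X :=
  iSup_le fun t => le_iSup (fun t : ℝ => MeasurableSpace.comap
    (fun ω : PathSpace X => ω.at t) ⊤) t.1

lemma past_mono {s t : ℝ} (h : s ≤ t) : past X s ≤ past X t :=
  iSup_le fun w => le_iSup (fun w : {w : ℝ // w ≤ t} => MeasurableSpace.comap
    (fun ω : PathSpace X => ω.at w.1) ⊤) ⟨w.1, w.2.trans h⟩

lemma measurableSet_past_event {s t : ℝ} (h : t ≤ s) (x : X) :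
    MeasurableSet[past X s] (event t x) :=
  le_iSup (fun w : {w : ℝ // w ≤ s} => MeasurableSpace.comap
    (fun ω : PathSpace X => ω.at w.1) ⊤) ⟨t, h⟩ _ ⟨{x}, trivial, rfl⟩

lemma measurableSet_event (t : ℝ) (x : X) : MeasurableSet (event t x) :=
  past_le t _ (measurableSet_past_event le_rfl x)

lemma event_inter_event_of_ne {t : ℝ} {x y : X} (h : x ≠ y) :
    event t x ∩ event t y = ∅ := by
  ext ω
  simp only [event, mem_inter_iff, mem_ofPred_eq, mem_empty_iff_false, iff_false, not_and]
  exact fun h1 h2 => h (h1.symm.trans h2)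

lemma iUnion_inter_event (B : Set (PathSpace X)) (t : ℝ) : ⋃ x, B ∩ event t x = B := by
  ext ω
  simp [event]

lemma measurable_comp_at {β : Type*} [MeasurableSpace β] (F : X → β) (t : ℝ) :
    Measurable fun ω : PathSpace X => F (ω.at t) := by
  intro S _
  exact le_iSup (fun t : ℝ => MeasurableSpace.comap (fun ω : PathSpace X => ω.at t) ⊤) t _
    ⟨F ⁻¹' S, trivial, rfl⟩

variable [Fintype X]

lemma measure_eq_sum_inter_event (P : Measure (PathSpace X)) {B : Set (PathSpace X)}
    (hB : MeasurableSet B) (t : ℝ) : P B = ∑ x, P (B ∩ event t x) := by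
  conv_lhs => rw [← iUnion_inter_event B t]
  rw [measure_iUnion, tsum_fintype]
  · intro x y hxy
    refine Disjoint.mono inter_subset_right inter_subset_right ?_
    exact disjoint_iff_inter_eq_empty.2 (event_inter_event_of_ne hxy)
  · exact fun x => hB.inter (measurableSet_event t x)

lemma real_eq_sum_inter_event (P : Measure (PathSpace X)) [IsFiniteMeasure P]
    {B : Set (PathSpace X)} (hB : MeasurableSet B) (t : ℝ) :
    P.real B = ∑ x, P.real (B ∩ event t x) := by
  simp only [Measure.real]
  rw [measure_eq_sum_inter_event P hB t, ENNReal.toReal_sum fun _ _ => measure_ne_top _ _]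

lemma integral_comp_at (P : Measure (PathSpace X)) [IsFiniteMeasure P] (F : X → ℝ) (t : ℝ) :
    Integrable (fun ω : PathSpace X => F (ω.at t)) P ∧
      ∫ ω, F (ω.at t) ∂P = ∑ x, marginal P t x * F x := by
  have e : (fun ω : PathSpace X => F (ω.at t)) =
      fun ω => ∑ x, (event t x).indicator (fun _ => F x) ω := by
    funext ω
    rw [Finset.sum_eq_single (ω.at t) (fun x _ hx => indicator_of_notMem
      (show ω ∉ event t x from fun h => hx h.symm) _) (fun h => absurd (Finset.mem_univ _) h)]
    exact (indicator_of_mem (show ω ∈ event t (ω.at t) from rfl) fun _ => F (ω.at t)).symm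
  have hi : ∀ x, Integrable ((event t x).indicator fun _ => F x) P := fun x =>
    (integrable_const _).indicator (measurableSet_event t x)
  rw [e]
  refine ⟨integrable_finsetSum _ fun x _ => hi x, ?_⟩
  rw [integral_finsetSum _ fun x _ => hi x]
  refine Finset.sum_congr rfl fun x _ => ?_
  rw [integral_indicator_const _ (measurableSet_event t x), smul_eq_mul, marginal]

lemma sum_marginal (P : Measure (PathSpace X)) [IsFiniteMeasure P] (t : ℝ) :
    ∑ x, marginal P t x = P.real univ := by
  rw [real_eq_sum_inter_event P MeasurableSet.univ t]
  simp [marginal]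

end Events

lemma cond_real_eq {Ω : Type*} [MeasurableSpace Ω] (P : Measure Ω) {A : Set Ω}
    (hA : MeasurableSet A) (B : Set Ω) :
    (ProbabilityTheory.cond P A).real B = (P.real A)⁻¹ * P.real (A ∩ B) := by
  rw [Measure.real, ProbabilityTheory.cond_apply hA, ENNReal.toReal_mul, ENNReal.toReal_inv]
  rfl

/-! ### Markov property of the reference chain. -/

section Markov

variable {X : Type*} [Fintype X] [DecidableEq X] {r : ℝ → X → X → ℝ} {p : ℝ → ℝ → X → X → ℝ}
  {μ : X → ℝ} {Pr : Measure (PathSpace X)}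
  (hr : ∀ y x, IntegrableOn (fun t => r t y x) (Icc 0 1)) (hp : IsTransitionKernel r p)
  (hPr : IsPathMeasure r μ Pr)

include hr hp hPr

/-- For a fixed past event `A`, the martingale problem says that `w ↦ Pr(A, X_w = z)` solves the
forward equation, so uniqueness propagates it by the kernel. -/
lemma real_inter_event_eq_sum {A : Set (PathSpace X)} {s t : ℝ} (hs : 0 ≤ s) (hst : s ≤ t)
    (ht : t ≤ 1) (hA : MeasurableSet[past X s] A) (y : X) :
    Pr.real (A ∩ event t y) = ∑ z, p s t y z * Pr.real (A ∩ event s z) := by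
  have := hPr.isProbabilityMeasure
  exact forward_solution_eq (a := fun w z => Pr.real (A ∩ event w z)) (D := 1) hr hp hs hst ht
    (fun w _ z => by rw [abs_of_nonneg measureReal_nonneg]; exact measureReal_le_one)
    (fun u v hu huv hv y => hPr.evolution u v (hs.trans hu) huv (hv.trans ht) A
      (past_mono hu A hA) y) y

/-- The Markov property of the reference chain. -/
lemma real_inter_event_inter_event {A : Set (PathSpace X)} {s t : ℝ} (hs : 0 ≤ s) (hst : s ≤ t)
    (ht : t ≤ 1) (hA : MeasurableSet[past X s] A) (x y : X) :
    Pr.real (A ∩ event s x ∩ event t y) = p s t y x * Pr.real (A ∩ event s x) := by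
  rw [real_inter_event_eq_sum hr hp hPr hs hst ht
    (hA.inter (measurableSet_past_event le_rfl x)) y, Finset.sum_eq_single x]
  · rw [inter_assoc, inter_self]
  · intro z _ hz
    rw [inter_assoc, event_inter_event_of_ne hz.symm, inter_empty, measureReal_empty, mul_zero]
  · simp

end Markov

/-! ### The endpoint tilt: potentials, marginals and conditionals. -/

section Tilt

variable {X : Type*}

/-- The path measure with density `α(X_0) b(X_1)` with respect to `Pr`. -/
noncomputable def tiltedMeasure (Pr : Measure (PathSpace X)) (α b : X → ℝ) :
    Measure (PathSpace X) :=
  Pr.withDensity fun ω => ENNReal.ofReal (α (ω.at 0) * b (ω.at 1))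

lemma measurable_tilt (α b : X → ℝ) :
    Measurable fun ω : PathSpace X => ENNReal.ofReal (α (ω.at 0) * b (ω.at 1)) :=
  ((measurable_comp_at α 0).mul (measurable_comp_at b 1)).ennreal_ofReal

variable [Fintype X]

lemma tiltedMeasure_apply (Pr : Measure (PathSpace X)) (α b : X → ℝ) {B : Set (PathSpace X)}
    (hB : MeasurableSet B) :
    tiltedMeasure Pr α b B =
      ∑ x, ∑ y, ENNReal.ofReal (α x * b y) * Pr (B ∩ event 0 x ∩ event 1 y) := by
  rw [measure_eq_sum_inter_event _ hB 0]
  refine Finset.sum_congr rfl fun x _ => ?_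
  have hBx := hB.inter (measurableSet_event 0 x)
  rw [measure_eq_sum_inter_event _ hBx 1]
  refine Finset.sum_congr rfl fun y _ => ?_
  have hBxy := hBx.inter (measurableSet_event 1 y)
  rw [tiltedMeasure, withDensity_apply _ hBxy, setLIntegral_congr_fun
    (g := fun _ => ENNReal.ofReal (α x * b y)) hBxy, setLIntegral_const]
  rintro ω ⟨⟨_, h0⟩, h1⟩
  simp only [event, mem_ofPred_eq] at h0 h1
  simp only [h0, h1]

lemma isFiniteMeasure_tiltedMeasure (Pr : Measure (PathSpace X)) [IsFiniteMeasure Pr]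
    (α b : X → ℝ) : IsFiniteMeasure (tiltedMeasure Pr α b) := by
  refine ⟨?_⟩
  rw [tiltedMeasure_apply _ _ _ MeasurableSet.univ]
  exact ENNReal.sum_lt_top.2 fun x _ => ENNReal.sum_lt_top.2 fun y _ =>
    ENNReal.mul_lt_top ENNReal.ofReal_lt_top (measure_lt_top _ _)

lemma tiltedMeasure_real (Pr : Measure (PathSpace X)) [IsFiniteMeasure Pr] {α b : X → ℝ}
    (hα : ∀ x, 0 ≤ α x) (hb : ∀ y, 0 ≤ b y) {B : Set (PathSpace X)} (hB : MeasurableSet B) :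
    (tiltedMeasure Pr α b).real B =
      ∑ x, ∑ y, α x * b y * Pr.real (B ∩ event 0 x ∩ event 1 y) := by
  have hfin : ∀ x y, ENNReal.ofReal (α x * b y) * Pr (B ∩ event 0 x ∩ event 1 y) ≠ ⊤ :=
    fun x y => ENNReal.mul_ne_top ENNReal.ofReal_ne_top (measure_ne_top _ _)
  rw [Measure.real, tiltedMeasure_apply _ _ _ hB,
    ENNReal.toReal_sum fun x _ => ENNReal.sum_ne_top.2 fun y _ => hfin x y]
  refine Finset.sum_congr rfl fun x _ => ?_
  rw [ENNReal.toReal_sum fun y _ => hfin x y]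
  refine Finset.sum_congr rfl fun y _ => ?_
  rw [ENNReal.toReal_mul, ENNReal.toReal_ofReal (mul_nonneg (hα x) (hb y)), Measure.real]

/-- The backward potential with terminal value `b`. -/
noncomputable def backwardPotential (p : ℝ → ℝ → X → X → ℝ) (b : X → ℝ) (t : ℝ) (x : X) : ℝ :=
  ∑ y, p t 1 y x * b y

/-- The forward potential with initial value `a`. -/
noncomputable def forwardPotential (p : ℝ → ℝ → X → X → ℝ) (a : X → ℝ) (t : ℝ) (x : X) : ℝ :=
  ∑ y, p 0 t x y * a y

variable [DecidableEq X] {r : ℝ → X → X → ℝ} {p : ℝ → ℝ → X → X → ℝ}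

section Potentials

variable (hp : IsTransitionKernel r p)
include hp

lemma backwardPotential_eq_sum (b : X → ℝ) {s t : ℝ} (hs : 0 ≤ s) (hst : s ≤ t) (ht : t ≤ 1)
    (x : X) : backwardPotential p b s x = ∑ y, p s t y x * backwardPotential p b t y := by
  simp only [backwardPotential, Finset.mul_sum]
  rw [Finset.sum_comm]
  refine Finset.sum_congr rfl fun y _ => ?_
  rw [hp.chapman_kolmogorov s t 1 hs hst ht le_rfl, Finset.sum_mul]
  exact Finset.sum_congr rfl fun z _ => by ring

lemma forwardPotential_eq_sum (a : X → ℝ) {s t : ℝ} (hs : 0 ≤ s) (hst : s ≤ t) (ht : t ≤ 1)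
    (x : X) : forwardPotential p a t x = ∑ y, p s t x y * forwardPotential p a s y := by
  simp only [forwardPotential, Finset.mul_sum]
  rw [Finset.sum_comm]
  refine Finset.sum_congr rfl fun y _ => ?_
  rw [hp.chapman_kolmogorov 0 s t le_rfl hs hst ht, Finset.sum_mul]
  exact Finset.sum_congr rfl fun z _ => by ring

lemma backwardPotential_nonneg {b : X → ℝ} (hb : ∀ y, 0 ≤ b y) {t : ℝ}
    (ht : t ∈ Icc (0 : ℝ) 1) (x : X) : 0 ≤ backwardPotential p b t x :=
  Finset.sum_nonneg fun y _ => mul_nonneg (hp.nonneg t 1 ht.1 ht.2 le_rfl y x) (hb y)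

lemma forwardPotential_nonneg {a : X → ℝ} (ha : ∀ y, 0 ≤ a y) {t : ℝ}
    (ht : t ∈ Icc (0 : ℝ) 1) (x : X) : 0 ≤ forwardPotential p a t x :=
  Finset.sum_nonneg fun y _ => mul_nonneg (hp.nonneg 0 t le_rfl ht.1 ht.2 x y) (ha y)

lemma abs_backwardPotential_le (b : X → ℝ) {t : ℝ} (ht : t ∈ Icc (0 : ℝ) 1) (x : X) :
    |backwardPotential p b t x| ≤ ∑ y, |b y| := by
  refine (Finset.abs_sum_le_sum_abs _ _).trans (Finset.sum_le_sum fun y _ => ?_)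
  rw [abs_mul]
  exact mul_le_of_le_one_left (abs_nonneg _) (abs_kernel_le_one hp ht.1 ht.2 le_rfl y x)

lemma backwardPotential_one (b : X → ℝ) (x : X) : backwardPotential p b 1 x = b x := by
  simp [backwardPotential, kernel_self hp zero_le_one le_rfl]

lemma forwardPotential_zero (a : X → ℝ) (x : X) : forwardPotential p a 0 x = a x := by
  simp [forwardPotential, kernel_self hp le_rfl zero_le_one]

lemma continuousOn_forwardPotential (a : X → ℝ) (x : X) :
    ContinuousOn (fun t => forwardPotential p a t x) (Icc 0 1) :=
  continuousOn_finsetSum _ fun y _ =>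
    (hp.continuousOn 0 le_rfl zero_le_one x y).mul continuousOn_const

end Potentials

lemma continuousOn_backwardPotential (hr : ∀ y x, IntegrableOn (fun t => r t y x) (Icc 0 1))
    (hp : IsTransitionKernel r p) (b : X → ℝ) (x : X) :
    ContinuousOn (fun t => backwardPotential p b t x) (Icc 0 1) :=
  continuousOn_potential hr hp
    (fun _ _ hs hst ht => backwardPotential_eq_sum hp b hs hst ht)
    (fun _ ht => abs_backwardPotential_le hp b ht) x

lemma sum_mul_real_event_zero_inter_event {μ : X → ℝ} {Pr : Measure (PathSpace X)}
    (hr : ∀ y x, IntegrableOn (fun t => r t y x) (Icc 0 1)) (hp : IsTransitionKernel r p)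
    (hPr : IsPathMeasure r μ Pr) (α : X → ℝ) {t : ℝ} (ht0 : 0 ≤ t) (ht1 : t ≤ 1) (y : X) :
    ∑ x, α x * Pr.real (event 0 x ∩ event t y) =
      forwardPotential p (fun x => μ x * α x) t y := by
  refine Finset.sum_congr rfl fun x _ => ?_
  have h := real_inter_event_inter_event hr hp hPr le_rfl ht0 ht1 MeasurableSet.univ x y
  rw [univ_inter] at h
  have h0 : Pr.real (event 0 x) = μ x := hPr.initial x
  rw [h, h0]
  ring

variable {μ α b : X → ℝ} {Pr : Measure (PathSpace X)}
  (hr : ∀ y x, IntegrableOn (fun t => r t y x) (Icc 0 1)) (hp : IsTransitionKernel r p)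
  (hPr : IsPathMeasure r μ Pr) (hα : ∀ x, 0 ≤ α x) (hb : ∀ y, 0 ≤ b y)
include hr hp hPr hα hb

/-- Given the past of `t`, the factor `α(X_0)` is known and `b(X_1)` averages to `φ_t(X_t)` by the
Markov property. -/
lemma tiltedMeasure_real_inter_event {A : Set (PathSpace X)} {t : ℝ} (ht0 : 0 ≤ t) (ht1 : t ≤ 1)
    (hA : MeasurableSet[past X t] A) (y : X) :
    (tiltedMeasure Pr α b).real (A ∩ event t y) =
      (∑ x, α x * Pr.real (A ∩ event 0 x ∩ event t y)) * backwardPotential p b t y := by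
  have := hPr.isProbabilityMeasure
  rw [tiltedMeasure_real Pr hα hb ((past_le t _ hA).inter (measurableSet_event t y)),
    Finset.sum_mul]
  refine Finset.sum_congr rfl fun x _ => ?_
  rw [backwardPotential, Finset.mul_sum]
  refine Finset.sum_congr rfl fun z _ => ?_
  rw [inter_right_comm A, real_inter_event_inter_event hr hp hPr ht0 ht1 le_rfl
    (hA.inter (measurableSet_past_event ht0 x)) y z]
  ring

lemma marginal_tiltedMeasure {t : ℝ} (ht0 : 0 ≤ t) (ht1 : t ≤ 1) (y : X) :
    marginal (tiltedMeasure Pr α b) t y =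
      backwardPotential p b t y * forwardPotential p (fun x => μ x * α x) t y := by
  have h := tiltedMeasure_real_inter_event hr hp hPr hα hb ht0 ht1 MeasurableSet.univ y
  simp only [univ_inter] at h
  rw [marginal, h, sum_mul_real_event_zero_inter_event hr hp hPr α ht0 ht1, mul_comm]

lemma tiltedMeasure_real_event_inter_event {s t : ℝ} (hs : 0 ≤ s) (hst : s ≤ t) (ht : t ≤ 1)
    (x y : X) :
    (tiltedMeasure Pr α b).real (event s x ∩ event t y) =
      forwardPotential p (fun x => μ x * α x) s x * p s t y x * backwardPotential p b t y := by
  rw [tiltedMeasure_real_inter_event hr hp hPr hα hb (hs.trans hst) ht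
    (measurableSet_past_event hst x) y,
    ← sum_mul_real_event_zero_inter_event hr hp hPr α hs (hst.trans ht) x]
  congr 1
  rw [Finset.sum_mul]
  refine Finset.sum_congr rfl fun z _ => ?_
  rw [inter_comm (event s x), real_inter_event_inter_event hr hp hPr hs hst ht
    (measurableSet_past_event hs z) x y]
  ring

lemma condProb_tiltedMeasure_forward {s t : ℝ} (hs : 0 ≤ s) (hst : s ≤ t) (ht : t ≤ 1)
    (x y : X) (hpos : 0 < marginal (tiltedMeasure Pr α b) s y) :
    condProb (tiltedMeasure Pr α b) t s x y =
      p s t x y * (backwardPotential p b t x / backwardPotential p b s y) := by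
  have h1 := marginal_tiltedMeasure hr hp hPr hα hb hs (hst.trans ht) y
  rw [h1] at hpos
  have h2 : backwardPotential p b s y ≠ 0 := left_ne_zero_of_mul hpos.ne'
  have h3 : forwardPotential p (fun x => μ x * α x) s y ≠ 0 := right_ne_zero_of_mul hpos.ne'
  rw [condProb, cond_real_eq _ (measurableSet_event s y),
    tiltedMeasure_real_event_inter_event hr hp hPr hα hb hs hst ht]
  rw [marginal] at h1
  rw [h1]
  field_simp

lemma condProb_tiltedMeasure_backward {s t : ℝ} (hs : 0 ≤ s) (hst : s ≤ t) (ht : t ≤ 1)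
    (x y : X) (hpos : 0 < marginal (tiltedMeasure Pr α b) t x) :
    condProb (tiltedMeasure Pr α b) s t y x =
      p s t x y * (forwardPotential p (fun x => μ x * α x) s y /
        forwardPotential p (fun x => μ x * α x) t x) := by
  have h1 := marginal_tiltedMeasure hr hp hPr hα hb (hs.trans hst) ht x
  rw [h1] at hpos
  have h2 : backwardPotential p b t x ≠ 0 := left_ne_zero_of_mul hpos.ne'
  have h3 : forwardPotential p (fun x => μ x * α x) t x ≠ 0 := right_ne_zero_of_mul hpos.ne'
  rw [condProb, cond_real_eq _ (measurableSet_event t x), inter_comm,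
    tiltedMeasure_real_event_inter_event hr hp hPr hα hb hs hst ht]
  rw [marginal] at h1
  rw [h1]
  field_simp

end Tilt

/-! ### Algebra of the h-transformed rate. -/

section TiltedRate

variable {X : Type*} [Fintype X] [DecidableEq X] {r : ℝ → X → X → ℝ} {φ : ℝ → X → ℝ}

/-- Clears the denominator. Division by zero gives 0, so where `φ w x = 0` the identity needs the
hypothesis `h`, which holds for almost every time by `ae_rate_mul_potential_eq_zero`. -/
lemma tiltedRate_mul {w : ℝ} {x : X} (h : φ w x = 0 → ∀ y, r w y x * φ w y = 0) (y : X) :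
    tiltedRate r φ w y x * φ w x =
      φ w y * r w y x - if y = x then ∑ z, r w z x * φ w z else 0 := by
  have hz : ∀ z, φ w z / φ w x * r w z x * φ w x = φ w z * r w z x := by
    intro z
    by_cases h0 : φ w x = 0
    · have := h h0 z
      rw [h0, mul_zero, mul_comm, this]
    · field_simp
  unfold tiltedRate
  split_ifs with hyx
  · subst hyx
    rw [neg_mul, Finset.sum_mul, Finset.sum_congr rfl fun z _ => hz z,
      ← Finset.add_sum_erase Finset.univ (fun z => r w z y * φ w z) (Finset.mem_univ y),
      Finset.sum_congr rfl fun z _ => mul_comm (φ w z) (r w z y)]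
    ring
  · rw [hz, sub_zero]

/-- The right side is the derivative of `c φ` when `c` solves the forward equation of `r` and `φ`
the backward one. -/
lemma sum_tiltedRate_mul {w : ℝ} (h : ∀ x, φ w x = 0 → ∀ y, r w y x * φ w y = 0) (c : X → ℝ)
    (y : X) : ∑ z, tiltedRate r φ w y z * (c z * φ w z) =
      (∑ z, r w y z * c z) * φ w y + c y * -∑ z, r w z y * φ w z := by
  have e : ∀ z, tiltedRate r φ w y z * (c z * φ w z) =
      r w y z * c z * φ w y - if y = z then c z * ∑ x, r w x z * φ w x else 0 := by
    intro z
    rw [mul_left_comm, tiltedRate_mul (h z) y, mul_sub, mul_ite, mul_zero]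
    ring
  rw [Finset.sum_congr rfl fun z _ => e z, Finset.sum_sub_distrib, Finset.sum_ite_eq,
    if_pos (Finset.mem_univ y), Finset.sum_mul]
  ring

lemma isRate_tiltedRate (hr : IsRate r) (hφ0 : ∀ t ∈ Icc (0 : ℝ) 1, ∀ x, 0 ≤ φ t x)
    (hφm : ∀ x, AEMeasurable (fun t => φ t x) (volume.restrict (Icc 0 1))) :
    IsRate (tiltedRate r φ) where
  aemeasurable y x := by
    have h : ∀ z, AEMeasurable (fun t => φ t z / φ t x * r t z x) (volume.restrict (Icc 0 1)) :=
      fun z => ((hφm z).div (hφm x)).mul (hr.aemeasurable z x)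
    unfold tiltedRate
    split_ifs with hyx
    · exact (Finset.aemeasurable_fun_sum _ fun z _ => h z).neg
    · exact h y
  nonneg t ht y x hyx := by
    rw [tiltedRate, if_neg hyx]
    exact mul_nonneg (div_nonneg (hφ0 t ht y) (hφ0 t ht x)) (hr.nonneg t ht y x hyx)
  sum_eq_zero t ht x := by
    rw [← Finset.add_sum_erase Finset.univ _ (Finset.mem_univ x), tiltedRate, if_pos rfl,
      neg_add_eq_zero]
    refine Finset.sum_congr rfl fun z hz => ?_
    rw [tiltedRate, if_neg (Finset.ne_of_mem_erase hz)]

end TiltedRate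

/-! ### The tilted measure solves the martingale problem of the tilted rate. -/

section TiltedPathMeasure

variable {X : Type*} [Fintype X] [DecidableEq X] {r : ℝ → X → X → ℝ} {p : ℝ → ℝ → X → X → ℝ}
  {μ α b : X → ℝ} {Pr : Measure (PathSpace X)}

lemma evolution_tiltedMeasure (hrate : IsRate r)
    (hr : ∀ y x, IntegrableOn (fun t => r t y x) (Icc 0 1)) (hp : IsTransitionKernel r p)
    (hPr : IsPathMeasure r μ Pr) (hα : ∀ x, 0 ≤ α x) (hb : ∀ y, 0 ≤ b y) {s t : ℝ}
    (hs : 0 ≤ s) (hst : s ≤ t) (ht : t ≤ 1) {A : Set (PathSpace X)}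
    (hA : MeasurableSet[past X s] A) (y : X) :
    (tiltedMeasure Pr α b).real (A ∩ event t y) = (tiltedMeasure Pr α b).real (A ∩ event s y) +
      ∫ w in s..t, ∑ z, tiltedRate r (backwardPotential p b) w y z *
        (tiltedMeasure Pr α b).real (A ∩ event w z) := by
  have := hPr.isProbabilityMeasure
  set φ := backwardPotential p b with hφdef
  have hφ : ∀ s t, 0 ≤ s → s ≤ t → t ≤ 1 → ∀ x, φ s x = ∑ y, p s t y x * φ t y :=
    fun _ _ hs hst ht => backwardPotential_eq_sum hp b hs hst ht
  have hC : ∀ t ∈ Icc (0 : ℝ) 1, ∀ x, |φ t x| ≤ ∑ y, |b y| :=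
    fun _ ht => abs_backwardPotential_le hp b ht
  -- The tilted mass of `A ∩ {X_w = z}` is `a w z * φ w z`. As a combination of reference
  -- probabilities, `a` solves the forward equation of `r`.
  set a : ℝ → X → ℝ := fun w z => ∑ x, α x * Pr.real (A ∩ event 0 x ∩ event w z) with ha
  have hPA : ∀ w ∈ Icc s t, ∀ z, (tiltedMeasure Pr α b).real (A ∩ event w z) = a w z * φ w z :=
    fun w hw z => tiltedMeasure_real_inter_event hr hp hPr hα hb (hs.trans hw.1) (hw.2.trans ht)
      (past_mono hw.1 _ hA) z
  have hA0 : ∀ x u, s ≤ u → MeasurableSet[past X u] (A ∩ event 0 x) := fun x u hu =>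
    (past_mono hu _ hA).inter (measurableSet_past_event (hs.trans hu) x)
  have hcont : ∀ x z, ContinuousOn (fun w => Pr.real (A ∩ event 0 x ∩ event w z)) (Icc s t) := by
    intro x z
    refine continuousOn_of_abs_sub_le_cumRate (D := 1) hr hs ht fun u v hu huv hv => ?_
    rw [hPr.evolution u v (hs.trans hu) huv (hv.trans ht) _ (hA0 x u hu) z, add_sub_cancel_left]
    exact abs_integral_le_cumRate hr (hs.trans hu) huv (hv.trans ht) fun w _ =>
      abs_sum_rate_mul_le z fun z' => by
        rw [abs_of_nonneg measureReal_nonneg]; exact measureReal_le_one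
  have hacont : ∀ z, ContinuousOn (fun w => a w z) (Icc s t) := fun z =>
    continuousOn_finsetSum _ fun x _ => continuousOn_const.mul (hcont x z)
  have hint : ∀ x, ∀ w ∈ Icc s t,
      IntervalIntegrable (fun q => ∑ z, r q y z * Pr.real (A ∩ event 0 x ∩ event q z)) volume s w :=
    fun x w hw => intervalIntegrable_sum fun z => intervalIntegrable_rate_mul
      (a := fun q z => Pr.real (A ∩ event 0 x ∩ event q z)) hr hs hw.1 (hw.2.trans ht)
      (fun z => (hcont x z).mono (Icc_subset_Icc le_rfl hw.2)) y z
  have hF : ∀ w ∈ Icc s t, a w y = a s y + ∫ q in s..w, ∑ z, r q y z * a q z := by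
    intro w hw
    have e : ∀ x, α x * Pr.real (A ∩ event 0 x ∩ event w y) =
        α x * Pr.real (A ∩ event 0 x ∩ event s y) +
          ∫ q in s..w, α x * ∑ z, r q y z * Pr.real (A ∩ event 0 x ∩ event q z) := by
      intro x
      rw [hPr.evolution s w hs hw.1 (hw.2.trans ht) _ (hA0 x s le_rfl) y, mul_add,
        intervalIntegral.integral_const_mul]
    simp only [ha]
    rw [Finset.sum_congr rfl fun x _ => e x, Finset.sum_add_distrib,
      ← intervalIntegral.integral_finsetSum fun x _ => (hint x w hw).const_mul _]
    congr 1
    refine intervalIntegral.integral_congr fun q _ => ?_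
    simp only [Finset.mul_sum]
    rw [Finset.sum_comm]
    exact Finset.sum_congr rfl fun _ _ => Finset.sum_congr rfl fun _ _ => by ring
  have hG : ∀ w ∈ Icc s t, φ w y = φ s y + ∫ q in s..w, -∑ z, r q z y * φ q z :=
    fun w hw => potential_backward hr hp hφ hC hs hw.1 (hw.2.trans ht) y
  have hprod := mul_sub_mul_eq_integral (F := fun w => a w y) (G := fun w => φ w y) hst
    (intervalIntegrable_sum fun z => intervalIntegrable_rate_mul hr hs hst ht hacont y z)
    (intervalIntegrable_sum_rate_mul_potential hr hp hφ hC hs hst ht y).neg hF hG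
  rw [hPA t ⟨hst, le_rfl⟩ y, hPA s ⟨le_rfl, hst⟩ y, ← sub_eq_iff_eq_add', hprod]
  apply intervalIntegral.integral_congr_ae
  have hae := ae_rate_mul_potential_eq_zero hr hp hφ hC hrate
    fun _ ht x => backwardPotential_nonneg hp hb ht x
  rw [ae_restrict_iff' measurableSet_Icc] at hae
  filter_upwards [hae] with w hw hwst
  rw [uIoc_of_le hst] at hwst
  have hw' : w ∈ Icc s t := Ioc_subset_Icc_self hwst
  simp only [hPA w hw']
  exact (sum_tiltedRate_mul (hw ⟨hs.trans hw'.1, hw'.2.trans ht⟩) (a w) y).symm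

/-- The tilted rate alone may be non-integrable where `φ` tends to zero; the factor `φ` in the
marginal cancels the denominator and leaves integrable rates times continuous functions. -/
lemma integrable_tiltedRate_mul_marginal (hrate : IsRate r)
    (hr : ∀ y x, IntegrableOn (fun t => r t y x) (Icc 0 1)) (hp : IsTransitionKernel r p)
    (hPr : IsPathMeasure r μ Pr) (hα : ∀ x, 0 ≤ α x) (hb : ∀ y, 0 ≤ b y) (y x : X) :
    IntegrableOn (fun t => tiltedRate r (backwardPotential p b) t y x *
      marginal (tiltedMeasure Pr α b) t x) (Icc 0 1) := by
  set φ := backwardPotential p b with hφdef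
  have hφ : ∀ s t, 0 ≤ s → s ≤ t → t ≤ 1 → ∀ x, φ s x = ∑ y, p s t y x * φ t y :=
    fun _ _ hs hst ht => backwardPotential_eq_sum hp b hs hst ht
  have hC : ∀ t ∈ Icc (0 : ℝ) 1, ∀ x, |φ t x| ≤ ∑ y, |b y| :=
    fun _ ht => abs_backwardPotential_le hp b ht
  have hi : ∀ z, IntegrableOn (fun t => r t z x * φ t z) (Icc 0 1) := fun z =>
    (hr z x).mul_continuousOn (continuousOn_backwardPotential hr hp b z) isCompact_Icc
  have hi' : IntegrableOn (fun t => (r t y x * φ t y - if y = x then ∑ z, r t z x * φ t z else 0) *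
      forwardPotential p (fun x => μ x * α x) t x) (Icc 0 1) := by
    refine IntegrableOn.mul_continuousOn ?_ (continuousOn_forwardPotential hp _ x) isCompact_Icc
    refine (hi y).sub ?_
    split_ifs
    · exact integrable_finsetSum _ fun z _ => hi z
    · exact integrableOn_zero
  refine hi'.congr ?_
  have hae := ae_rate_mul_potential_eq_zero hr hp hφ hC hrate
    fun _ ht x => backwardPotential_nonneg hp hb ht x
  filter_upwards [hae, ae_restrict_mem measurableSet_Icc] with t ht htI
  rw [marginal_tiltedMeasure hr hp hPr hα hb htI.1 htI.2, ← mul_assoc, tiltedRate_mul (ht x) y,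
    mul_comm (φ t y)]

lemma isPathMeasure_tiltedMeasure (hrate : IsRate r)
    (hr : ∀ y x, IntegrableOn (fun t => r t y x) (Icc 0 1)) (hp : IsTransitionKernel r p)
    (hPr : IsPathMeasure r μ Pr) (hα : ∀ x, 0 ≤ α x) (hb : ∀ y, 0 ≤ b y)
    (hμ : ∑ x, μ x = 1) (hinit : ∀ x, μ x * α x * ∑ y, p 0 1 y x * b y = μ x) :
    IsPathMeasure (tiltedRate r (backwardPotential p b)) μ (tiltedMeasure Pr α b) := by
  have := hPr.isProbabilityMeasure
  have hfin := isFiniteMeasure_tiltedMeasure Pr α b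
  have h0 : ∀ x, marginal (tiltedMeasure Pr α b) 0 x = μ x := by
    intro x
    rw [marginal_tiltedMeasure hr hp hPr hα hb le_rfl zero_le_one, forwardPotential_zero hp,
      mul_comm]
    exact hinit x
  refine ⟨⟨?_⟩, h0, integrable_tiltedRate_mul_marginal hrate hr hp hPr hα hb,
    fun s t hs hst ht A hA y => evolution_tiltedMeasure hrate hr hp hPr hα hb hs hst ht hA y⟩
  have h1 : (tiltedMeasure Pr α b).real univ = 1 := by
    rw [← sum_marginal _ 0, Finset.sum_congr rfl fun x _ => h0 x, hμ]
  rwa [Measure.real, ENNReal.toReal_eq_one_iff] at h1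

end TiltedPathMeasure

/-! ### Relative entropy with respect to an endpoint tilt. -/

section KullbackLeibler

variable {X : Type*} [Fintype X] {Pr P : Measure (PathSpace X)} {α b : X → ℝ}

lemma ae_ne_zero_at [IsFiniteMeasure P] {t : ℝ} {b : X → ℝ}
    (h : ∀ y, marginal P t y ≠ 0 → b y ≠ 0) : ∀ᵐ ω ∂P, b (ω.at t) ≠ 0 := by
  have h1 : ∀ y, ∀ᵐ ω ∂P, ω.at t = y → b y ≠ 0 := by
    intro y
    by_cases hy : b y = 0
    · have h0 : P (event t y) = 0 := by
        have : marginal P t y = 0 := by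
          by_contra hne
          exact h y hne hy
        exact (measureReal_eq_zero_iff).1 this
      filter_upwards [measure_eq_zero_iff_ae_notMem.1 h0] with ω hω hωy
      exact absurd hωy hω
    · exact Eventually.of_forall fun _ _ => hy
  filter_upwards [ae_all_iff.2 h1] with ω hω
  exact hω _ rfl

/-- The logarithm of the density of the tilted measure, integrated against `P`. -/
noncomputable def tiltCost (P : Measure (PathSpace X)) (α b : X → ℝ) : ℝ :=
  ∑ x, marginal P 0 x * Real.log (α x) + ∑ y, marginal P 1 y * Real.log (b y)

lemma integral_log_tilt [IsFiniteMeasure P] (α b : X → ℝ) : Integrable (fun ω : PathSpace X =>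
      Real.log (α (ω.at 0)) + Real.log (b (ω.at 1))) P ∧
    ∫ ω, (Real.log (α (ω.at 0)) + Real.log (b (ω.at 1))) ∂P = tiltCost P α b := by
  have h1 := integral_comp_at P (fun x => Real.log (α x)) 0
  have h2 := integral_comp_at P (fun y => Real.log (b y)) 1
  refine ⟨h1.1.add h2.1, ?_⟩
  rw [integral_add h1.1 h2.1, h1.2, h2.2, tiltCost]

variable [IsFiniteMeasure P]
  (hα : ∀ x, 0 < α x) (hb : ∀ y, 0 ≤ b y) (hpos : ∀ y, marginal P 1 y ≠ 0 → b y ≠ 0)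
  (hac : P ≪ Pr)
include hα hb hpos hac

/-- The density of the tilt vanishes only where `b(X_1) = 0`, which is `P`-null by `hpos`. -/
lemma absolutelyContinuous_tiltedMeasure : P ≪ tiltedMeasure Pr α b := by
  intro B hB
  rw [tiltedMeasure, withDensity_apply_eq_zero (measurable_tilt α b)] at hB
  have h1 := measure_eq_zero_iff_ae_notMem.1 (hac hB)
  rw [measure_eq_zero_iff_ae_notMem]
  filter_upwards [h1, ae_ne_zero_at hpos] with ω h2 h3 h4
  refine h2 ⟨?_, h4⟩
  rw [mem_ofPred_eq, ENNReal.ofReal_ne_zero_iff]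
  exact mul_pos (hα _) (lt_of_le_of_ne (hb _) (Ne.symm h3))

variable [IsFiniteMeasure Pr]

/-- Logarithm of the chain rule for Radon–Nikodym derivatives through the tilted measure. The added
term takes finitely many values, so it never affects integrability. -/
lemma llr_ae_eq_llr_tiltedMeasure_add : llr P Pr =ᵐ[P] fun ω =>
    llr P (tiltedMeasure Pr α b) ω + (Real.log (α (ω.at 0)) + Real.log (b (ω.at 1))) := by
  have := isFiniteMeasure_tiltedMeasure Pr α b
  have hac' := absolutelyContinuous_tiltedMeasure hα hb hpos hac
  have h1 := hac.ae_le (Measure.rnDeriv_mul_rnDeriv (κ := Pr) hac')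
  have h2 := hac.ae_le (Measure.rnDeriv_withDensity Pr (measurable_tilt α b))
  filter_upwards [h1, h2, ae_ne_zero_at hpos, Measure.rnDeriv_pos hac',
    hac'.ae_le (Measure.rnDeriv_lt_top P (tiltedMeasure Pr α b))] with ω h1 h2 h3 h4 h5
  have h6 : 0 < b (ω.at 1) := lt_of_le_of_ne (hb _) (Ne.symm h3)
  have h7 : (tiltedMeasure Pr α b).rnDeriv Pr ω = ENNReal.ofReal (α (ω.at 0) * b (ω.at 1)) := h2
  rw [llr, llr, ← h1, Pi.mul_apply, h7, ENNReal.toReal_mul,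
    ENNReal.toReal_ofReal (mul_pos (hα _) h6).le,
    Real.log_mul (ENNReal.toReal_pos h4.ne' h5.ne).ne' (mul_pos (hα _) h6).ne',
    Real.log_mul (hα _).ne' h6.ne']

lemma integrable_llr_tiltedMeasure_iff :
    Integrable (llr P (tiltedMeasure Pr α b)) P ↔ Integrable (llr P Pr) P := by
  rw [integrable_congr (llr_ae_eq_llr_tiltedMeasure_add hα hb hpos hac)]
  exact ((integrable_add_iff_integrable_left (integral_log_tilt α b).1)).symm

/-- The Pythagorean identity for the relative entropy with respect to a tilted measure. -/
lemma toReal_klDiv_eq_add (hmass : P univ = Pr univ) (hmass' : P univ = tiltedMeasure Pr α b univ)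
    (hint : Integrable (llr P Pr) P) :
    (InformationTheory.klDiv P Pr).toReal =
      (InformationTheory.klDiv P (tiltedMeasure Pr α b)).toReal + tiltCost P α b := by
  have := isFiniteMeasure_tiltedMeasure Pr α b
  have hac' := absolutelyContinuous_tiltedMeasure hα hb hpos hac
  rw [InformationTheory.toReal_klDiv_of_measure_eq hac hmass,
    InformationTheory.toReal_klDiv_of_measure_eq hac' hmass',
    integral_congr_ae (llr_ae_eq_llr_tiltedMeasure_add hα hb hpos hac),
    integral_add ((integrable_llr_tiltedMeasure_iff hα hb hpos hac).2 hint) (integral_log_tilt α b).1,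
    (integral_log_tilt α b).2]

end KullbackLeibler

/-! ### Optimality and uniqueness of the tilted measure. -/

section Optimality

variable {X : Type*} [Fintype X] {Pr : Measure (PathSpace X)} {α b : X → ℝ}
  (hα : ∀ x, 0 < α x) (hb : ∀ y, 0 ≤ b y)
  (hpos : ∀ y, marginal (tiltedMeasure Pr α b) 1 y ≠ 0 → b y ≠ 0)
  [IsProbabilityMeasure Pr] [IsProbabilityMeasure (tiltedMeasure Pr α b)]
include hα hb hpos

lemma klDiv_tiltedMeasure :
    InformationTheory.klDiv (tiltedMeasure Pr α b) Pr ≠ ⊤ ∧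
      (InformationTheory.klDiv (tiltedMeasure Pr α b) Pr).toReal =
        tiltCost (tiltedMeasure Pr α b) α b := by
  have hac : tiltedMeasure Pr α b ≪ Pr := withDensity_absolutelyContinuous _ _
  have hint : Integrable (llr (tiltedMeasure Pr α b) Pr) (tiltedMeasure Pr α b) := by
    rw [← integrable_llr_tiltedMeasure_iff hα hb hpos hac,
      integrable_congr (llr_self (tiltedMeasure Pr α b))]
    exact integrable_zero _ _ _
  refine ⟨InformationTheory.klDiv_ne_top hac hint, ?_⟩
  rw [toReal_klDiv_eq_add hα hb hpos hac (by simp) rfl hint, InformationTheory.klDiv_self]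
  simp

variable {P : Measure (PathSpace X)} [IsProbabilityMeasure P]
  (h0 : ∀ x, marginal P 0 x = marginal (tiltedMeasure Pr α b) 0 x)
  (h1 : ∀ x, marginal P 1 x = marginal (tiltedMeasure Pr α b) 1 x)
include h0 h1

/-- `tiltCost` sees only the two endpoint marginals, so it agrees for `P` and the tilted measure,
and for the latter it is the divergence from `Pr`. -/
lemma toReal_klDiv_eq_add_klDiv_tiltedMeasure (h : InformationTheory.klDiv P Pr ≠ ⊤) :
    InformationTheory.klDiv P (tiltedMeasure Pr α b) ≠ ⊤ ∧
    (InformationTheory.klDiv P Pr).toReal =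
      (InformationTheory.klDiv P (tiltedMeasure Pr α b)).toReal +
        (InformationTheory.klDiv (tiltedMeasure Pr α b) Pr).toReal := by
  obtain ⟨hac, hint⟩ := InformationTheory.klDiv_ne_top_iff.1 h
  have hposP : ∀ y, marginal P 1 y ≠ 0 → b y ≠ 0 := fun y hy => hpos y (h1 y ▸ hy)
  refine ⟨InformationTheory.klDiv_ne_top (absolutelyContinuous_tiltedMeasure hα hb hposP hac)
    ((integrable_llr_tiltedMeasure_iff hα hb hposP hac).2 hint), ?_⟩
  rw [toReal_klDiv_eq_add hα hb hposP hac (by simp) (by simp) hint,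
    (klDiv_tiltedMeasure hα hb hpos).2]
  simp only [tiltCost, h0, h1]

lemma klDiv_tiltedMeasure_le :
    InformationTheory.klDiv (tiltedMeasure Pr α b) Pr ≤ InformationTheory.klDiv P Pr := by
  by_cases h : InformationTheory.klDiv P Pr = ⊤
  · rw [h]
    exact le_top
  · rw [← ENNReal.toReal_le_toReal (klDiv_tiltedMeasure hα hb hpos).1 h,
      (toReal_klDiv_eq_add_klDiv_tiltedMeasure hα hb hpos h0 h1 h).2]
    exact le_add_of_nonneg_left ENNReal.toReal_nonneg

lemma eq_tiltedMeasure_of_klDiv_le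
    (hle : InformationTheory.klDiv P Pr ≤ InformationTheory.klDiv (tiltedMeasure Pr α b) Pr) :
    P = tiltedMeasure Pr α b := by
  have hfin := (klDiv_tiltedMeasure hα hb hpos).1
  have h := ne_top_of_le_ne_top hfin hle
  obtain ⟨h2, h3⟩ := toReal_klDiv_eq_add_klDiv_tiltedMeasure hα hb hpos h0 h1 h
  have h4 := ENNReal.toReal_mono hfin hle
  have h5 : (InformationTheory.klDiv P (tiltedMeasure Pr α b)).toReal = 0 :=
    le_antisymm (by linarith) ENNReal.toReal_nonneg
  rw [← InformationTheory.klDiv_eq_zero_iff]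
  exact (ENNReal.toReal_eq_zero_iff _).1 h5 |>.resolve_right h2

end Optimality

/-! ### Recovering the rate from the path measure. -/

section RateUniqueness

variable {X : Type*} [Fintype X]

/-- An integrable function all of whose integrals from the left end point vanish is zero. -/
lemma ae_eq_zero_of_integral_eq_zero {f : ℝ → ℝ} {s t : ℝ} (hst : s ≤ t)
    (hf : IntervalIntegrable f volume s t) (h : ∀ w ∈ Icc s t, ∫ q in s..w, f q = 0) :
    ∀ᵐ w, w ∈ Ioo s t → f w = 0 := by
  filter_upwards [hf.ae_hasDerivAt_integral] with w hw hwst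
  have hd := hw (by rw [uIcc_of_le hst]; exact Ioo_subset_Icc_self hwst) s (by simp)
  have hc : (fun w => ∫ q in s..w, f q) =ᶠ[𝓝 w] fun _ => 0 := by
    filter_upwards [Icc_mem_nhds hwst.1 hwst.2] with v hv
    exact h v hv
  exact hd.unique ((hasDerivAt_const w (0 : ℝ)).congr_of_eventuallyEq hc)

/-- A competitor rate is integrable only against the marginals, so joint probabilities are handled
by domination. -/
lemma integrableOn_rate_mul_of_le_marginal {u : ℝ → X → X → ℝ} {μ : X → ℝ}
    {P : Measure (PathSpace X)} (hu : IsRate u) (hP : IsPathMeasure u μ P) {s : ℝ} (hs : 0 ≤ s)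
    {q : ℝ → ℝ} {z : X} (hq : ContinuousOn q (Icc s 1)) (hq0 : ∀ w, 0 ≤ q w)
    (hqm : ∀ w, q w ≤ marginal P w z) (y : X) :
    IntegrableOn (fun w => u w y z * q w) (Icc s 1) := by
  have hsub : Icc s 1 ⊆ Icc (0 : ℝ) 1 := Icc_subset_Icc hs le_rfl
  refine Integrable.mono ((hP.integrable y z).mono_set hsub) ?_ (Eventually.of_forall fun w => ?_)
  · exact (((hu.aemeasurable y z).mono_set hsub).mul
      (hq.aemeasurable measurableSet_Icc)).aestronglyMeasurable
  · rw [norm_mul, norm_mul, Real.norm_of_nonneg (hq0 w),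
      Real.norm_of_nonneg ((hq0 w).trans (hqm w))]
    exact mul_le_mul_of_nonneg_left (hqm w) (norm_nonneg _)

/-- The rate of a stochastically continuous path measure is determined almost everywhere on the
support of the marginals. -/
lemma ae_rate_eq_of_isPathMeasure [DecidableEq X] {u u' : ℝ → X → X → ℝ} {μ : X → ℝ}
    {P : Measure (PathSpace X)}
    (hu : IsRate u) (hu' : IsRate u') (hP : IsPathMeasure u μ P) (hP' : IsPathMeasure u' μ P)
    (hcont : ∀ s, 0 ≤ s → s ≤ 1 → ∀ x z,
      ContinuousOn (fun w => P.real (event s x ∩ event w z)) (Icc s 1))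
    (hlim : ∀ w, 0 < w → w ≤ 1 → ∀ x z,
      Tendsto (fun s => P.real (event s x ∩ event w z)) (𝓝[<] w)
        (𝓝 (if z = x then marginal P w x else 0))) :
    ∀ᵐ t ∂(volume.restrict (Icc (0 : ℝ) 1)), ∀ x y, 0 < marginal P t x → u t y x = u' t y x := by
  have := hP.isProbabilityMeasure
  have hint : ∀ {v : ℝ → X → X → ℝ}, IsRate v → IsPathMeasure v μ P → ∀ s, 0 ≤ s → ∀ t, s ≤ t →
      t ≤ 1 → ∀ x y, IntervalIntegrable (fun w => ∑ z, v w y z * P.real (event s x ∩ event w z))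
        volume s t := by
    intro v hv hPv s hs t hst ht x y
    refine intervalIntegrable_sum fun z => ?_
    rw [intervalIntegrable_iff_integrableOn_Ioc_of_le hst]
    exact (integrableOn_rate_mul_of_le_marginal hv hPv hs (hcont s hs (hst.trans ht) x z)
      (fun w => measureReal_nonneg)
      (fun w => measureReal_mono inter_subset_right) y).mono_set
      (Ioc_subset_Icc_self.trans (Icc_subset_Icc le_rfl ht))
  -- Both rates give the same increments when tested on `{X_q = x}`. Rational `q` keep the union of
  -- exceptional sets null.
  have hzero : ∀ q : ℚ, 0 ≤ (q : ℝ) → (q : ℝ) ≤ 1 → ∀ x y, ∀ᵐ w : ℝ, w ∈ Ioo (q : ℝ) 1 →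
      ∑ z, (u w y z - u' w y z) * P.real (event q x ∩ event w z) = 0 := by
    intro q hq0 hq1 x y
    have h1 : ∀ t, (q : ℝ) ≤ t → t ≤ 1 → _ := fun t => hint hu hP q hq0 t (x := x) (y := y)
    have h2 : ∀ t, (q : ℝ) ≤ t → t ≤ 1 → _ := fun t => hint hu' hP' q hq0 t (x := x) (y := y)
    have h3 := ae_eq_zero_of_integral_eq_zero hq1 ((h1 1 hq1 le_rfl).sub (h2 1 hq1 le_rfl)) (by
      intro t ht
      rw [intervalIntegral.integral_sub (h1 t ht.1 ht.2) (h2 t ht.1 ht.2)]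
      have e1 := hP.evolution q t hq0 ht.1 ht.2 _ (measurableSet_past_event le_rfl x) y
      have e2 := hP'.evolution q t hq0 ht.1 ht.2 _ (measurableSet_past_event le_rfl x) y
      linarith)
    filter_upwards [h3] with w hw hwq
    have h4 := hw hwq
    simp only [sub_mul, Finset.sum_sub_distrib]
    exact h4
  have hzero' : ∀ᵐ w : ℝ, ∀ q : ℚ, 0 ≤ (q : ℝ) → (q : ℝ) ≤ 1 → ∀ x y, w ∈ Ioo (q : ℝ) 1 →
      ∑ z, (u w y z - u' w y z) * P.real (event q x ∩ event w z) = 0 := by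
    simp only [ae_all_iff]
    exact hzero
  have h01 : ∀ᵐ w : ℝ, w ≠ 0 ∧ w ≠ 1 := by
    have h0 : ∀ᵐ w : ℝ, w ≠ 0 := by simp [ae_iff, measure_singleton]
    have h1 : ∀ᵐ w : ℝ, w ≠ 1 := by simp [ae_iff, measure_singleton]
    exact h0.and h1
  rw [ae_restrict_iff' measurableSet_Icc]
  filter_upwards [hzero', h01] with w hw hw01 hwI x y hpos
  have hw0 : 0 < w := lt_of_le_of_ne hwI.1 (Ne.symm hw01.1)
  have hw1 : w < 1 := lt_of_le_of_ne hwI.2 hw01.2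
  have ht : Tendsto (fun s => ∑ z, (u w y z - u' w y z) * P.real (event s x ∩ event w z)) (𝓝[<] w)
      (𝓝 (∑ z, (u w y z - u' w y z) * if z = x then marginal P w x else 0)) :=
    tendsto_finsetSum _ fun z _ => (hlim w hw0 hwI.2 x z).const_mul _
  -- The sum is known to vanish only at rational `s`, which accumulate at `w` from the left; its
  -- limit keeps just the term `z = x`.
  have hfreq : ∃ᶠ s in 𝓝[<] w,
      ∑ z, (u w y z - u' w y z) * P.real (event s x ∩ event w z) ∈ ({0} : Set ℝ) := by
    rw [frequently_iff]
    intro U hU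
    obtain ⟨l, hl, hlU⟩ := (mem_nhdsLT_iff_exists_Ioo_subset' hw0).1 hU
    obtain ⟨q, hq1, hq2⟩ := exists_rat_btwn (max_lt hl hw0)
    refine ⟨q, hlU ⟨(le_max_left _ _).trans_lt hq1, hq2⟩, ?_⟩
    exact hw q ((le_max_right _ _).trans hq1.le) (hq2.le.trans hwI.2) x y ⟨hq2, hw1⟩
  have hmem := isClosed_singleton.mem_of_frequently_of_tendsto hfreq ht
  simp only [mul_ite, mul_zero, Finset.sum_ite_eq', Finset.mem_univ, if_true,
    mem_singleton_iff, mul_eq_zero, hpos.ne', or_false] at hmem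
  exact sub_eq_zero.1 hmem

end RateUniqueness

/-! ### Short-time behaviour of the reference kernel. -/

section Limits

variable {X : Type*} [Fintype X] [DecidableEq X] {r : ℝ → X → X → ℝ} {p : ℝ → ℝ → X → X → ℝ}

lemma tendsto_kernel_left (hr : ∀ y x, IntegrableOn (fun t => r t y x) (Icc 0 1))
    (hp : IsTransitionKernel r p) {w : ℝ} (hw0 : 0 < w) (hw1 : w ≤ 1) (y x : X) :
    Tendsto (fun s => p s w y x) (𝓝[<] w) (𝓝 (if y = x then 1 else 0)) := by
  have hIcc : Icc (0 : ℝ) w ∈ 𝓝[<] w := Icc_mem_nhdsLT hw0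
  have hM : Tendsto (fun s => cumRate r w - cumRate r s) (𝓝[<] w) (𝓝 0) := by
    have h : Tendsto (cumRate r) (𝓝[<] w) (𝓝 (cumRate r w)) :=
      ((continuousOn_cumRate hr) w ⟨hw0.le, hw1⟩).mono_of_mem_nhdsWithin
        (mem_of_superset hIcc (Icc_subset_Icc le_rfl hw1))
    simpa using h.const_sub (cumRate r w)
  rw [tendsto_iff_norm_sub_tendsto_zero]
  refine squeeze_zero' (Eventually.of_forall fun _ => norm_nonneg _) ?_ hM
  filter_upwards [hIcc] with s hs
  exact abs_kernel_sub_le hr hp hs.1 hs.2 hw1 y x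

/-- Right-continuity of `r` at `t` makes the integrand of the forward equation right-continuous
there, with value `r t y x` because the kernel starts at the identity. -/
lemma tendsto_kernel_div (hr : ∀ y x, IntegrableOn (fun t => r t y x) (Icc 0 1))
    (hp : IsTransitionKernel r p) {t : ℝ} (ht0 : 0 ≤ t) (ht1 : t < 1)
    (hc : ∀ y x, ContinuousWithinAt (fun w => r w y x) (Ici t) t) {x y : X} (hyx : y ≠ x) :
    Tendsto (fun h : ℝ => p t (t + h) y x / h) (𝓝[>] 0) (𝓝 (r t y x)) := by
  set f : ℝ → ℝ := fun w => ∑ z, r w y z * p t w z x with hf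
  have hIcc : Icc t 1 ∈ 𝓝[≥] t := Icc_mem_nhdsGE ht1
  have hft : f t = r t y x := by
    simp [hf, kernel_self hp ht0 ht1.le]
  have hfc : ContinuousWithinAt f (Ioi t) t := by
    refine ContinuousWithinAt.mono (t := Ici t) ?_ Ioi_subset_Ici_self
    refine tendsto_finsetSum _ fun z _ => (hc y z).mul ?_
    exact ((hp.continuousOn t ht0 ht1.le z x) t ⟨le_rfl, ht1.le⟩).mono_of_mem_nhdsWithin hIcc
  have hint : IntervalIntegrable f volume t 1 := intervalIntegrable_sum fun z =>
    intervalIntegrable_rate_mul (a := fun w z => p t w z x) hr ht0 ht1.le le_rfl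
      (fun z => hp.continuousOn t ht0 ht1.le z x) y z
  have hmeas : StronglyMeasurableAtFilter f (𝓝[>] t) volume :=
    ⟨Ioc t 1, Ioc_mem_nhdsGT ht1,
      ((intervalIntegrable_iff_integrableOn_Ioc_of_le ht1.le).1 hint).aestronglyMeasurable⟩
  have hd : HasDerivWithinAt (fun w => ∫ q in t..w, f q) (f t) (Ici t) t :=
    intervalIntegral.integral_hasDerivWithinAt_right (by simp) hmeas hfc
  rw [← hasDerivWithinAt_Ioi_iff_Ici, hasDerivWithinAt_iff_tendsto_slope' (by simp), hft] at hd
  have hshift : Tendsto (fun h : ℝ => t + h) (𝓝[>] 0) (𝓝[>] t) := by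
    refine tendsto_nhdsWithin_iff.2 ⟨?_, ?_⟩
    · have : Tendsto (fun h : ℝ => t + h) (𝓝 0) (𝓝 (t + 0)) :=
        (continuous_const.add continuous_id).tendsto 0
      rw [add_zero] at this
      exact this.mono_left nhdsWithin_le_nhds
    · filter_upwards [self_mem_nhdsWithin] with h hh
      exact lt_add_of_pos_right t hh
  refine (hd.comp hshift).congr' ?_
  filter_upwards [Ioc_mem_nhdsGT (sub_pos.2 ht1)] with h hh
  rw [hp.forward t (t + h) ht0 (by linarith [hh.1]) (by linarith [hh.2]) y x, if_neg hyx, zero_add]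
  simp [slope_def_field, hf]

end Limits

/-! ### Continuity and short-time limits under the tilted measure. -/

section Bridge

variable {X : Type*} [Fintype X] [DecidableEq X] {r : ℝ → X → X → ℝ} {p : ℝ → ℝ → X → X → ℝ}
  {μ α b : X → ℝ} {Pr : Measure (PathSpace X)}
  (hr : ∀ y x, IntegrableOn (fun t => r t y x) (Icc 0 1)) (hp : IsTransitionKernel r p)
  (hPr : IsPathMeasure r μ Pr) (hα : ∀ x, 0 ≤ α x) (hb : ∀ y, 0 ≤ b y)
include hr hp hPr hα hb

lemma continuousOn_tiltedMeasure_real {s : ℝ} (hs : 0 ≤ s) (hs1 : s ≤ 1) (x z : X) :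
    ContinuousOn (fun w => (tiltedMeasure Pr α b).real (event s x ∩ event w z)) (Icc s 1) := by
  refine ContinuousOn.congr ?_ fun w hw =>
    tiltedMeasure_real_event_inter_event hr hp hPr hα hb hs hw.1 hw.2 x z
  exact (continuousOn_const.mul (hp.continuousOn s hs hs1 z x)).mul
    ((continuousOn_backwardPotential hr hp b z).mono (Icc_subset_Icc hs le_rfl))

lemma tendsto_tiltedMeasure_real_left {w : ℝ} (hw0 : 0 < w) (hw1 : w ≤ 1) (x z : X) :
    Tendsto (fun s => (tiltedMeasure Pr α b).real (event s x ∩ event w z)) (𝓝[<] w)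
      (𝓝 (if z = x then marginal (tiltedMeasure Pr α b) w x else 0)) := by
  have hIcc : Icc (0 : ℝ) w ∈ 𝓝[<] w := Icc_mem_nhdsLT hw0
  have h1 : Tendsto (fun s => forwardPotential p (fun x => μ x * α x) s x) (𝓝[<] w)
      (𝓝 (forwardPotential p (fun x => μ x * α x) w x)) :=
    ((continuousOn_forwardPotential hp _ x) w ⟨hw0.le, hw1⟩).mono_of_mem_nhdsWithin
      (mem_of_superset hIcc (Icc_subset_Icc le_rfl hw1))
  have h2 := (h1.mul (tendsto_kernel_left hr hp hw0 hw1 z x)).mul_const (backwardPotential p b w z)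
  have e : forwardPotential p (fun x => μ x * α x) w x * (if z = x then 1 else 0) *
      backwardPotential p b w z = if z = x then marginal (tiltedMeasure Pr α b) w x else 0 := by
    split_ifs with hzx
    · rw [marginal_tiltedMeasure hr hp hPr hα hb hw0.le hw1, hzx]
      ring
    · ring
  rw [e] at h2
  refine h2.congr' ?_
  filter_upwards [hIcc] with s hs
  exact (tiltedMeasure_real_event_inter_event hr hp hPr hα hb hs.1 hs.2 hw1 x z).symm

lemma tendsto_condProb_tiltedMeasure_div {t : ℝ} (ht0 : 0 ≤ t) (ht1 : t < 1)
    (hc : ∀ y x, ContinuousWithinAt (fun w => r w y x) (Ici t) t) {x y : X} (hyx : y ≠ x)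
    (hpos : 0 < marginal (tiltedMeasure Pr α b) t x) :
    Tendsto (fun h : ℝ => condProb (tiltedMeasure Pr α b) (t + h) t y x / h) (𝓝[>] 0)
      (𝓝 (backwardPotential p b t y / backwardPotential p b t x * r t y x)) := by
  have hφ : Tendsto (fun h : ℝ => backwardPotential p b (t + h) y) (𝓝[>] 0)
      (𝓝 (backwardPotential p b t y)) := by
    have h1 : ContinuousWithinAt (fun w => backwardPotential p b w y) (Ici t) t :=
      ((continuousOn_backwardPotential hr hp b y) t ⟨ht0, ht1.le⟩).mono_of_mem_nhdsWithin
        (mem_of_superset (Icc_mem_nhdsGE ht1) (Icc_subset_Icc ht0 le_rfl))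
    refine h1.tendsto.comp (tendsto_nhdsWithin_iff.2 ⟨?_, ?_⟩)
    · have : Tendsto (fun h : ℝ => t + h) (𝓝 0) (𝓝 (t + 0)) :=
        (continuous_const.add continuous_id).tendsto 0
      rw [add_zero] at this
      exact this.mono_left nhdsWithin_le_nhds
    · filter_upwards [self_mem_nhdsWithin] with h hh
      exact le_add_of_nonneg_right (mem_Ioi.1 hh).le
  have h2 := (hφ.div_const (backwardPotential p b t x)).mul (tendsto_kernel_div hr hp ht0 ht1 hc hyx)
  refine h2.congr' ?_
  filter_upwards [Ioc_mem_nhdsGT (sub_pos.2 ht1)] with h hh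
  rw [condProb_tiltedMeasure_forward hr hp hPr hα hb ht0 (by linarith [hh.1]) (by linarith [hh.2])
    y x hpos]
  ring

end Bridge

end SchrodingerBridge

/-! ### Assembly of the theorem. -/

theorem mainTheorem1 {X : Type*} [Fintype X] [DecidableEq X]
    (r : ℝ → X → X → ℝ) (hr : SchrodingerBridge.IsRate r)
    (hr_int : ∀ y x, IntegrableOn (fun t => r t y x) (Icc 0 1))
    (μ ν : X → ℝ) (hμ : μ ∈ stdSimplex ℝ X) (hν : ν ∈ stdSimplex ℝ X)
    (p : ℝ → ℝ → X → X → ℝ) (hp : SchrodingerBridge.IsTransitionKernel r p)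
    (Pr : Measure (SchrodingerBridge.PathSpace X))
    (hPr : SchrodingerBridge.IsPathMeasure r μ Pr)
    (hfeas : ∃ π : X → X → ℝ, (∀ x y, 0 ≤ π x y) ∧ (∀ x, ∑ y, π x y = μ x) ∧
      (∀ y, ∑ x, π x y = ν y) ∧
      ∀ x y, 0 < π x y ↔ 0 < μ x ∧ 0 < p 0 1 y x ∧ 0 < ν y) :
    ∃ (φ φh : ℝ → X → ℝ) (Pstar : Measure (SchrodingerBridge.PathSpace X)),
      -- the potentials are nonnegative
      (∀ t ∈ Icc (0 : ℝ) 1, ∀ x, 0 ≤ φ t x ∧ 0 ≤ φh t x) ∧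
      -- backward and forward propagation under the reference kernel
      (∀ s t : ℝ, 0 ≤ s → s < t → t ≤ 1 → ∀ x,
        φ s x = ∑ y, p s t y x * φ t y ∧ φh t x = ∑ y, p s t x y * φh s y) ∧
      -- the tilted rate is optimal, with path measure `Pstar`
      SchrodingerBridge.IsOptimal μ ν Pr (SchrodingerBridge.tiltedRate r φ) Pstar ∧
      -- every optimal rate has the path measure `Pstar` and is given by the formula
      (∀ u P, SchrodingerBridge.IsOptimal μ ν Pr u P →
        P = Pstar ∧
        ∀ᵐ t ∂(volume.restrict (Icc (0 : ℝ) 1)), ∀ x y, y ≠ x →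
          0 < SchrodingerBridge.marginal Pstar t x →
          u t y x = φ t y / φ t x * r t y x) ∧
      -- the pointwise rate of `Pstar`, at times where the reference rate is right-continuous
      (∀ t : ℝ, 0 ≤ t → t < 1 →
        (∀ y x, ContinuousWithinAt (fun w => r w y x) (Ici t) t) →
        ∀ x y, y ≠ x → 0 < SchrodingerBridge.marginal Pstar t x →
          Tendsto (fun h : ℝ => SchrodingerBridge.condProb Pstar (t + h) t y x / h) (𝓝[>] 0)
            (𝓝 (φ t y / φ t x * r t y x))) ∧
      -- marginals
      (∀ t ∈ Icc (0 : ℝ) 1, ∀ x, SchrodingerBridge.marginal Pstar t x = φ t x * φh t x) ∧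
      -- forward conditionals
      (∀ s t : ℝ, 0 ≤ s → s < t → t ≤ 1 → ∀ x y,
        0 < SchrodingerBridge.marginal Pstar s y →
          SchrodingerBridge.condProb Pstar t s x y = p s t x y * (φ t x / φ s y)) ∧
      -- backward conditionals
      (∀ s t : ℝ, 0 ≤ s → s < t → t ≤ 1 → ∀ x y,
        0 < SchrodingerBridge.marginal Pstar t x →
          SchrodingerBridge.condProb Pstar s t y x = p s t x y * (φh s y / φh t x)) := by
  obtain ⟨α, b, hα, hb, hinit, hterm⟩ := SchrodingerBridge.exists_schrodinger_system (p 0 1)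
    (hp.nonneg 0 1 le_rfl zero_le_one le_rfl) μ ν hμ.1 hfeas
  have hα0 : ∀ x, 0 ≤ α x := fun x => (hα x).le
  have := hPr.isProbabilityMeasure
  have hpath := SchrodingerBridge.isPathMeasure_tiltedMeasure hr hr_int hp hPr hα0 hb hμ.2 hinit
  have := hpath.isProbabilityMeasure
  have hmarg1 : ∀ y, SchrodingerBridge.marginal (SchrodingerBridge.tiltedMeasure Pr α b) 1 y
      = ν y := by
    intro y
    rw [SchrodingerBridge.marginal_tiltedMeasure hr_int hp hPr hα0 hb zero_le_one le_rfl,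
      SchrodingerBridge.backwardPotential_one hp, mul_comm]
    exact hterm y
  -- The terminal equation has `b y` as a factor of `ν y`, so `b` cannot vanish on the support of
  -- `ν`.
  have hpos : ∀ y, SchrodingerBridge.marginal (SchrodingerBridge.tiltedMeasure Pr α b) 1 y ≠ 0 →
      b y ≠ 0 := by
    intro y hy hby
    rw [hmarg1, ← hterm y, hby, mul_zero] at hy
    exact hy rfl
  have hφ0 : ∀ t ∈ Icc (0 : ℝ) 1, ∀ x, 0 ≤ SchrodingerBridge.backwardPotential p b t x :=
    fun _ ht x => SchrodingerBridge.backwardPotential_nonneg hp hb ht x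
  have hrate : SchrodingerBridge.IsRate
      (SchrodingerBridge.tiltedRate r (SchrodingerBridge.backwardPotential p b)) :=
    SchrodingerBridge.isRate_tiltedRate hr hφ0 fun x =>
      (SchrodingerBridge.continuousOn_backwardPotential hr_int hp b x).aemeasurable
        measurableSet_Icc
  have hadm : SchrodingerBridge.IsAdmissible μ ν
      (SchrodingerBridge.tiltedRate r (SchrodingerBridge.backwardPotential p b))
      (SchrodingerBridge.tiltedMeasure Pr α b) := ⟨hrate, hpath, hmarg1⟩
  refine ⟨SchrodingerBridge.backwardPotential p b,
    SchrodingerBridge.forwardPotential p fun x => μ x * α x,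
    SchrodingerBridge.tiltedMeasure Pr α b, fun t ht x => ⟨hφ0 t ht x, ?_⟩,
    fun s t hs hst ht x => ⟨SchrodingerBridge.backwardPotential_eq_sum hp b hs hst.le ht x,
      SchrodingerBridge.forwardPotential_eq_sum hp _ hs hst.le ht x⟩,
    ⟨hadm, fun u' P' h' => ?_⟩, fun u P hopt => ?_, fun t ht0 ht1 hc x y hyx hx => ?_,
    fun t ht x => ?_, fun s t hs hst ht x y hy => ?_, fun s t hs hst ht x y hx => ?_⟩
  · exact SchrodingerBridge.forwardPotential_nonneg hp
      (fun y => mul_nonneg (hμ.1 y) (hα0 y)) ht x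
  · have := h'.isPathMeasure.isProbabilityMeasure
    exact SchrodingerBridge.klDiv_tiltedMeasure_le hα hb hpos
      (fun x => by rw [h'.isPathMeasure.initial, hpath.initial])
      (fun x => by rw [h'.terminal, hmarg1])
  · have := hopt.admissible.isPathMeasure.isProbabilityMeasure
    have hP : P = SchrodingerBridge.tiltedMeasure Pr α b :=
      SchrodingerBridge.eq_tiltedMeasure_of_klDiv_le hα hb hpos
        (fun x => by rw [hopt.admissible.isPathMeasure.initial, hpath.initial])
        (fun x => by rw [hopt.admissible.terminal, hmarg1]) (hopt.le _ _ hadm)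
    refine ⟨hP, ?_⟩
    -- Once `P` is the tilted measure, it solves the martingale problem for both `u` and the tilted
    -- rate.
    have hae := SchrodingerBridge.ae_rate_eq_of_isPathMeasure hopt.admissible.isRate hrate
      (hP ▸ hopt.admissible.isPathMeasure) hpath
      (fun s hs hs1 => SchrodingerBridge.continuousOn_tiltedMeasure_real hr_int hp hPr hα0 hb hs hs1)
      (fun w hw0 hw1 =>
        SchrodingerBridge.tendsto_tiltedMeasure_real_left hr_int hp hPr hα0 hb hw0 hw1)
    filter_upwards [hae] with t ht x y hyx hx
    rw [ht x y hx, SchrodingerBridge.tiltedRate, if_neg hyx]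
  · exact SchrodingerBridge.tendsto_condProb_tiltedMeasure_div hr_int hp hPr hα0 hb ht0 ht1 hc
      hyx hx
  · exact SchrodingerBridge.marginal_tiltedMeasure hr_int hp hPr hα0 hb ht.1 ht.2 x
  · exact SchrodingerBridge.condProb_tiltedMeasure_forward hr_int hp hPr hα0 hb hs hst.le ht x y hy
  · exact SchrodingerBridge.condProb_tiltedMeasure_backward hr_int hp hPr hα0 hb hs hst.le ht x y hx
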